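/- Let $X=\begin{pmatrix}0&1\\1&0\end{pmatrix}$, $Y=\begin{pmatrix}0&-i\\i&0\end{pmatrix}$, $Z_0=\begin{pmatrix}1&0\\0&-1\end{pmatrix}$ be the Pauli matrices, and let $G\subseteq U(4)$ be the group generated by the sixteen matrices $\sigma\otimes\tau$ with $\sigma,\tau\in\{I_2,X,Y,Z_0\}$. The two-qubit Clifford group is \[\mathcal C_2=N_{U(4)}(G)\,/\,\{cI_4: c\in\mathbb C,\ |c|=1\},\] the normalizer of $G$ in $U(4)$ modulo global phase. Let $H=\frac1{\sqrt2}\begin{pmatrix}1&1\\1&-1\end{pmatrix}$ and $P=\begin{pmatrix}1&0\\0&i\end{pmatrix}$. In $\mathcal C_2$ let $e$ be the identity element and let $H_1,H_2,P_1,P_2,Z$ be the classes of $H\otimes I_2$, $I_2\otimes H$, $P\otimes I_2$, $I_2\otimes P$ and of the controlled-$Z$ gate $\mathrm{diag}(1,1,1,-1)$, respectively. Then the following hold. (a) $\mathcal C_2$ has exactly 21 conjugacy classes $K_1,\dots,K_{21}$; a representative $g_j$ and the size of $K_j$ are given by \[\begin{array}{r|r|l}j&|K_j|&g_j\\\hline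 1&1&e\\ 2&640&P_2P_1H_2H_1\\ 3&60&Z\\ 4&1920&ZH_2H_1\\ 5&15&P_1^2\\ 6&180&P_2P_1\\ 7&720&ZH_1\\ 8&30&P_1\\ 9&360&P_2H_1\\ 10&180&H_2P_2^2H_2Z\\ 11&90&P_2P_1^2\\ 12&120&H_1\\ 13&160&P_1H_1\\ 14&480&P_2^2P_1H_1\\ 15&960&P_2P_1H_1\\ 16&2304&ZP_1H_2H_1\\ 17&180&H_2H_1\\ 18&720&H_1H_2P_2P_1^{-1}ZH_1H_2Z\\ 19&960&P_1H_2H_1\\ 20&720&H_1ZH_2P_2Z\\ 21&720&ZP_2H_1\\ \end{array}\] (b) $\mathcal C_2$ has exactly 21 irreducible complex characters $\chi_1,\dots,\chi_{21}$, and their values are given by the character table \[\begin{array}{c|rrrrrrrrrrrrrrrrrrrrr}&K_{1}&K_{2}&K_{3}&K_{4}&K_{5}&K_{6}&K_{7}&K_{8}&K_{9}&K_{10}&K_{11}&K_{12}&K_{13}&K_{14}&K_{15}&K_{16}&K_{17}&K_{18}&K_{19}&K_{20}&K_{21}\\\hline \chi_{1}&1&1&1&1&1&1&1&1&1&1&1&1&1&1&1&1&1&1&1&1&1\\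 \chi_{2}&1&1&-1&-1&1&1&1&-1&1&-1&-1&-1&1&1&-1&1&1&1&-1&-1&-1\\ \chi_{3}&5&-1&-1&-1&5&1&-1&3&1&-1&3&3&2&2&0&0&1&-1&0&1&1\\ \chi_{4}&5&-1&1&1&5&1&-1&-3&1&1&-3&-3&2&2&0&0&1&-1&0&-1&-1\\ \chi_{5}&5&2&-3&0&5&1&-1&1&1&-3&1&1&-1&-1&1&0&1&-1&1&-1&-1\\ \chi_{6}&5&2&3&0&5&1&-1&-1&1&3&-1&-1&-1&-1&-1&0&1&-1&-1&1&1\\ \chi_{7}&9&0&-3&0&9&1&1&-3&1&-3&-3&-3&0&0&0&-1&1&1&0&1&1\\ \chi_{8}&9&0&3&0&9&1&1&3&1&3&3&3&0&0&0&-1&1&1&0&-1&-1\\ \chi_{9}&10&1&-2&1&10&-2&0&2&-2&-2&2&2&1&1&-1&0&-2&0&-1&0&0\\ \chi_{10}&10&1&2&-1&10&-2&0&-2&-2&2&-2&-2&1&1&1&0&-2&0&1&0&0\\ \chi_{11}&15&0&3&0&-1&-1&-1&-5&-1&-1&3&-1&3&-1&1&0&3&1&-1&1&-1\\ \chi_{12}&15&0&-3&0&-1&3&1&-7&-1&1&1&1&3&-1&-1&0&-1&-1&1&1&-1\\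 \chi_{13}&15&0&-3&0&-1&-1&-1&5&-1&1&-3&1&3&-1&-1&0&3&1&1&-1&1\\ \chi_{14}&15&0&3&0&-1&3&1&7&-1&-1&-1&-1&3&-1&1&0&-1&-1&-1&-1&1\\ \chi_{15}&16&-2&0&0&16&0&0&0&0&0&0&0&-2&-2&0&1&0&0&0&0&0\\ \chi_{16}&30&0&-6&0&-2&2&0&-2&-2&2&-2&2&-3&1&1&0&2&0&-1&0&0\\ \chi_{17}&30&0&6&0&-2&2&0&2&-2&-2&2&-2&-3&1&-1&0&2&0&1&0&0\\ \chi_{18}&45&0&-3&0&-3&1&-1&9&1&1&1&-3&0&0&0&0&-3&1&0&1&-1\\ \chi_{19}&45&0&3&0&-3&1&-1&-9&1&-1&-1&3&0&0&0&0&-3&1&0&-1&1\\ \chi_{20}&45&0&-3&0&-3&-3&1&-3&1&1&5&-3&0&0&0&0&1&-1&0&-1&1\\ \chi_{21}&45&0&3&0&-3&-3&1&3&1&-1&-5&3&0&0&0&0&1&-1&0&1&-1\\ \end{array}\] (c) Let $\mathcal M_4$ be the matrix representation of $\mathcal C_2$, that is, the space of complex $4\times4$ matrices on which the class of $A$ acts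 by $M\mapsto AMA^{-1}$. Its character equals $\chi_1+\chi_{14}$. -/

import Mathlib

open scoped Kronecker Matrix

noncomputable section

namespace Clifford

/-! ## One-qubit matrices -/

/-- The Pauli matrix `X`. -/
def pauliX : Matrix (Fin 2) (Fin 2) ℂ := !![0, 1; 1, 0]

/-- The Pauli matrix `Y`. -/
def pauliY : Matrix (Fin 2) (Fin 2) ℂ := !![0, -Complex.I; Complex.I, 0]

/-- The Pauli matrix `Z`. -/
def pauliZ : Matrix (Fin 2) (Fin 2) ℂ := !![1, 0; 0, -1]

/-- The four one-qubit Pauli matrices. -/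
def pauliOne : Set (Matrix (Fin 2) (Fin 2) ℂ) := {1, pauliX, pauliY, pauliZ}

/-- The Hadamard gate. -/
def hadamard : Matrix (Fin 2) (Fin 2) ℂ := ((Real.sqrt 2 : ℝ) : ℂ)⁻¹ • !![1, 1; 1, -1]

/-- The phase gate. -/
def phaseGate : Matrix (Fin 2) (Fin 2) ℂ := !![1, 0; 0, Complex.I]

/-- The controlled-`Z` gate, `|0⟩⟨0| ⊗ 1 + |1⟩⟨1| ⊗ Z`. -/
def controlledZ : Matrix (Fin 2 × Fin 2) (Fin 2 × Fin 2) ℂ :=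
  !![1, 0; 0, 0] ⊗ₖ (1 : Matrix (Fin 2) (Fin 2) ℂ) + !![0, 0; 0, 1] ⊗ₖ pauliZ

/-! ## The two-qubit Clifford group -/

/-- The unitary group of `ℂ² ⊗ ℂ²`. -/
abbrev U4 : Type := Matrix.unitaryGroup (Fin 2 × Fin 2) ℂ

/-- The sixteen two-qubit Pauli matrices `σ ⊗ τ`. -/
def pauliTwo : Set U4 :=
  {A | ∃ σ ∈ pauliOne, ∃ τ ∈ pauliOne, (A : Matrix (Fin 2 × Fin 2) (Fin 2 × Fin 2) ℂ) = σ ⊗ₖ τ}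

/-- The subgroup of the unitary group generated by the two-qubit Pauli matrices. -/
def pauliGroup : Subgroup U4 := Subgroup.closure pauliTwo

/-- The unitary matrices that normalize the group generated by the Pauli matrices. -/
def cliffordUnitaries : Subgroup U4 := Subgroup.normalizer (pauliGroup : Set U4)

/-- The global phases: the scalar matrices among the Clifford unitaries. -/
def globalPhase : Subgroup cliffordUnitaries where
  carrier := {A | ∃ c : ℂ, (A.1 : Matrix (Fin 2 × Fin 2) (Fin 2 × Fin 2) ℂ) = c • 1}
  one_mem' := ⟨1, by simp⟩
  mul_mem' := by
    rintro A B ⟨c, hc⟩ ⟨d, hd⟩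
    refine ⟨c * d, ?_⟩
    simp [hc, hd, smul_smul, mul_comm]
  inv_mem' := by
    rintro A ⟨c, hc⟩
    refine ⟨star c, ?_⟩
    simp [hc]

instance globalPhase_normal : globalPhase.Normal where
  conj_mem := by
    rintro A ⟨c, hc⟩ B
    refine ⟨c, ?_⟩
    have hB : (B.1 : Matrix (Fin 2 × Fin 2) (Fin 2 × Fin 2) ℂ) * star B.1.1 = 1 := B.1.2.2
    simp [hc, hB]

/-- The two-qubit Clifford group: the normalizer of the Pauli group, up to global phase. -/
abbrev C2 : Type := cliffordUnitaries ⧸ globalPhase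

/-! ## The gates lie in the Clifford group -/

lemma sqrt_two_inv_sq : (((Real.sqrt 2 : ℝ) : ℂ)⁻¹) * (((Real.sqrt 2 : ℝ) : ℂ)⁻¹) = 2⁻¹ := by
  rw [← mul_inv, ← Complex.ofReal_mul, Real.mul_self_sqrt (by norm_num)]
  norm_num

lemma star_hadamard : star hadamard = hadamard := by
  ext i j
  fin_cases i <;> fin_cases j <;> simp [hadamard, Matrix.star_apply]

lemma hadamard_sq : hadamard * hadamard = 1 := by
  rw [hadamard, Matrix.smul_mul, Matrix.mul_smul, smul_smul, sqrt_two_inv_sq]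
  ext i j
  fin_cases i <;> fin_cases j <;> norm_num [Matrix.mul_apply]

lemma hadamard_mem : hadamard ∈ Matrix.unitaryGroup (Fin 2) ℂ := by
  rw [Matrix.mem_unitaryGroup_iff, star_hadamard, hadamard_sq]

lemma phaseGate_mem : phaseGate ∈ Matrix.unitaryGroup (Fin 2) ℂ := by
  rw [Matrix.mem_unitaryGroup_iff]
  ext i j
  fin_cases i <;> fin_cases j <;> simp [phaseGate, Matrix.mul_apply, Matrix.star_apply]

lemma controlledZ_eq : controlledZ =
    Matrix.diagonal (fun p => if p = (1, 1) then (-1 : ℂ) else 1) := by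
  ext ⟨i, j⟩ ⟨k, l⟩
  fin_cases i <;> fin_cases j <;> fin_cases k <;> fin_cases l <;>
    simp [controlledZ, pauliZ, Matrix.diagonal]

lemma controlledZ_sq : controlledZ * controlledZ = 1 := by
  rw [controlledZ_eq, Matrix.diagonal_mul_diagonal, ← Matrix.diagonal_one]
  congr 1
  ext p
  split_ifs <;> simp

lemma star_controlledZ : star controlledZ = controlledZ := by
  rw [controlledZ_eq, Matrix.star_eq_conjTranspose, Matrix.diagonal_conjTranspose]
  congr 1
  ext p
  simp only [Pi.star_apply]
  split_ifs <;> simp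

lemma controlledZ_mem : controlledZ ∈ Matrix.unitaryGroup (Fin 2 × Fin 2) ℂ := by
  rw [Matrix.mem_unitaryGroup_iff, star_controlledZ, controlledZ_sq]

lemma pauliOne_mem {σ : Matrix (Fin 2) (Fin 2) ℂ} (hσ : σ ∈ pauliOne) :
    σ ∈ Matrix.unitaryGroup (Fin 2) ℂ := by
  rw [Matrix.mem_unitaryGroup_iff]
  rcases hσ with rfl | rfl | rfl | rfl
  · simp
  all_goals
    ext i j
    fin_cases i <;> fin_cases j <;>
      simp [pauliX, pauliY, pauliZ, Matrix.mul_apply, Matrix.star_apply]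

/-- The two-qubit unitary `σ ⊗ τ`. -/
def tensor (σ τ : Matrix (Fin 2) (Fin 2) ℂ) (hσ : σ ∈ Matrix.unitaryGroup (Fin 2) ℂ)
    (hτ : τ ∈ Matrix.unitaryGroup (Fin 2) ℂ) : U4 :=
  ⟨σ ⊗ₖ τ, Matrix.kronecker_mem_unitary hσ hτ⟩

lemma pauliX_mem : pauliX ∈ pauliOne := by simp [pauliOne]

lemma pauliY_mem : pauliY ∈ pauliOne := by simp [pauliOne]

lemma pauliZ_mem : pauliZ ∈ pauliOne := by simp [pauliOne]

lemma one_mem_pauliOne : (1 : Matrix (Fin 2) (Fin 2) ℂ) ∈ pauliOne := by simp [pauliOne]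

lemma pauliXYZ : pauliX * pauliY * pauliZ = Complex.I • 1 := by
  ext i j
  fin_cases i <;> fin_cases j <;>
    simp [pauliX, pauliY, pauliZ, Matrix.mul_apply]

lemma tensor_mem {σ τ : Matrix (Fin 2) (Fin 2) ℂ} (hσ : σ ∈ pauliOne) (hτ : τ ∈ pauliOne) :
    tensor σ τ (pauliOne_mem hσ) (pauliOne_mem hτ) ∈ pauliGroup :=
  Subgroup.subset_closure ⟨σ, hσ, τ, hτ, rfl⟩

lemma mem_pauliGroup_of_eq {A : U4} (k : ℕ) {σ τ : Matrix (Fin 2) (Fin 2) ℂ}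
    (hσ : σ ∈ pauliOne) (hτ : τ ∈ pauliOne)
    (hA : (A : Matrix (Fin 2 × Fin 2) (Fin 2 × Fin 2) ℂ) = Complex.I ^ k • (σ ⊗ₖ τ)) :
    A ∈ pauliGroup := by
  set J : U4 := tensor _ _ (pauliOne_mem pauliX_mem) (pauliOne_mem one_mem_pauliOne) *
    tensor _ _ (pauliOne_mem pauliY_mem) (pauliOne_mem one_mem_pauliOne) *
    tensor _ _ (pauliOne_mem pauliZ_mem) (pauliOne_mem one_mem_pauliOne) with hJ
  have hJm : J ∈ pauliGroup :=
    mul_mem (mul_mem (tensor_mem pauliX_mem one_mem_pauliOne)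
      (tensor_mem pauliY_mem one_mem_pauliOne)) (tensor_mem pauliZ_mem one_mem_pauliOne)
  have hJv : (J : Matrix (Fin 2 × Fin 2) (Fin 2 × Fin 2) ℂ) = Complex.I • 1 := by
    simp only [hJ, Matrix.UnitaryGroup.mul_val, tensor, ← Matrix.mul_kronecker_mul, pauliXYZ]
    simp [Matrix.smul_kronecker]
  have : A = J ^ k * tensor σ τ (pauliOne_mem hσ) (pauliOne_mem hτ) := by
    apply Subtype.ext
    rw [Matrix.UnitaryGroup.mul_val, SubmonoidClass.coe_pow, hJv, hA, smul_pow, one_pow]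
    simp [tensor]
  rw [this]
  exact mul_mem (pow_mem hJm k) (tensor_mem hσ hτ)

lemma mem_cliffordUnitaries {A : U4} (h4 : A ^ 4 = 1)
    (h : ∀ s ∈ pauliTwo, A * s * A⁻¹ ∈ pauliGroup) : A ∈ cliffordUnitaries := by
  have key : ∀ x ∈ pauliGroup, A * x * A⁻¹ ∈ pauliGroup := by
    intro x hx
    have : pauliGroup ≤ pauliGroup.comap (MulAut.conj A).toMonoidHom := by
      rw [pauliGroup, Subgroup.closure_le]
      intro s hs
      exact h s hs
    exact this hx
  refine Subgroup.mem_normalizer_iff.2 fun x => ⟨key x, fun hx => ?_⟩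
  have h3 := key _ (key _ (key _ hx))
  have : A * (A * (A * (A * x * A⁻¹) * A⁻¹) * A⁻¹) * A⁻¹ = A ^ 4 * x * (A ^ 4)⁻¹ := by
    simp only [pow_succ, pow_zero, one_mul, mul_inv_rev, mul_assoc]
  rwa [this, h4, one_mul, inv_one, mul_one] at h3

/-- Conjugation by `σ` maps each Pauli matrix to a Pauli matrix up to a power of `i`. -/
def PreservesPauli (σ : Matrix (Fin 2) (Fin 2) ℂ) : Prop :=
  ∀ τ ∈ pauliOne, ∃ k : ℕ, ∃ ρ ∈ pauliOne, σ * τ * star σ = Complex.I ^ k • ρ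

lemma preservesPauli_one : PreservesPauli 1 := fun τ hτ => ⟨0, τ, hτ, by simp⟩

lemma preservesPauli_hadamard : PreservesPauli hadamard := by
  have e (τ : Matrix (Fin 2) (Fin 2) ℂ) : hadamard * τ * star hadamard =
      (2⁻¹ : ℂ) • (!![1, 1; 1, -1] * τ * !![1, 1; 1, -1]) := by
    rw [star_hadamard, hadamard]
    simp only [Matrix.smul_mul, Matrix.mul_smul, smul_smul, sqrt_two_inv_sq]
  rintro τ (rfl | rfl | rfl | rfl)
  · refine ⟨0, 1, one_mem_pauliOne, ?_⟩
    rw [mul_one, star_hadamard, hadamard_sq]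
    simp
  · refine ⟨0, pauliZ, pauliZ_mem, ?_⟩
    rw [e]
    ext i j
    fin_cases i <;> fin_cases j <;>
      simp [pauliX, pauliZ] <;> norm_num
  · refine ⟨2, pauliY, pauliY_mem, ?_⟩
    rw [e]
    ext i j
    fin_cases i <;> fin_cases j <;>
      simp [pauliY] <;> ring
  · refine ⟨0, pauliX, pauliX_mem, ?_⟩
    rw [e]
    ext i j
    fin_cases i <;> fin_cases j <;>
      simp [pauliX, pauliZ] <;> norm_num

lemma preservesPauli_phaseGate : PreservesPauli phaseGate := by
  rintro τ (rfl | rfl | rfl | rfl)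
  · refine ⟨0, 1, one_mem_pauliOne, ?_⟩
    rw [mul_one, (Matrix.mem_unitaryGroup_iff).1 phaseGate_mem]
    simp
  · refine ⟨0, pauliY, pauliY_mem, ?_⟩
    ext i j
    fin_cases i <;> fin_cases j <;>
      simp [pauliX, pauliY, phaseGate, Matrix.mul_apply, Matrix.star_apply]
  · refine ⟨2, pauliX, pauliX_mem, ?_⟩
    ext i j
    fin_cases i <;> fin_cases j <;>
      simp [pauliX, pauliY, phaseGate, Matrix.mul_apply, Matrix.star_apply]
  · refine ⟨0, pauliZ, pauliZ_mem, ?_⟩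
    ext i j
    fin_cases i <;> fin_cases j <;>
      simp [pauliZ, phaseGate, Matrix.mul_apply, Matrix.star_apply]

lemma hadamard_pow_four : hadamard ^ 4 = 1 := by
  rw [show 4 = 2 * 2 from rfl, pow_mul, pow_two hadamard, hadamard_sq, one_pow]

lemma phaseGate_pow_four : phaseGate ^ 4 = 1 := by
  have : phaseGate ^ 2 = pauliZ := by
    ext i j
    fin_cases i <;> fin_cases j <;> simp [phaseGate, pauliZ, pow_two, Matrix.mul_apply]
  rw [show 4 = 2 * 2 from rfl, pow_mul, this, pow_two]
  ext i j
  fin_cases i <;> fin_cases j <;> simp [pauliZ, Matrix.mul_apply]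

lemma kronecker_pow (σ τ : Matrix (Fin 2) (Fin 2) ℂ) (k : ℕ) :
    (σ ⊗ₖ τ) ^ k = (σ ^ k) ⊗ₖ (τ ^ k) := by
  induction k with
  | zero => simp
  | succ k ih => rw [pow_succ, ih, pow_succ, pow_succ, Matrix.mul_kronecker_mul]

lemma tensor_mem_cliffordUnitaries {σ τ : Matrix (Fin 2) (Fin 2) ℂ}
    (hσ : σ ∈ Matrix.unitaryGroup (Fin 2) ℂ) (hτ : τ ∈ Matrix.unitaryGroup (Fin 2) ℂ)
    (hσ4 : σ ^ 4 = 1) (hτ4 : τ ^ 4 = 1) (pσ : PreservesPauli σ) (pτ : PreservesPauli τ) :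
    tensor σ τ hσ hτ ∈ cliffordUnitaries := by
  apply mem_cliffordUnitaries
  · apply Subtype.ext
    rw [SubmonoidClass.coe_pow, tensor, kronecker_pow, hσ4, hτ4]
    simp
  · rintro s ⟨α, hα, β, hβ, hs⟩
    obtain ⟨k, α', hα', ek⟩ := pσ α hα
    obtain ⟨l, β', hβ', el⟩ := pτ β hβ
    refine mem_pauliGroup_of_eq (k + l) hα' hβ' ?_
    rw [Matrix.UnitaryGroup.mul_val, Matrix.UnitaryGroup.mul_val, Matrix.UnitaryGroup.inv_val, hs,
      tensor, Matrix.star_eq_conjTranspose, Matrix.conjTranspose_kronecker,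
      ← Matrix.mul_kronecker_mul, ← Matrix.mul_kronecker_mul, ← Matrix.star_eq_conjTranspose,
      ← Matrix.star_eq_conjTranspose, ek, el, Matrix.smul_kronecker, Matrix.kronecker_smul,
      smul_smul, pow_add]

lemma controlledZ_mem_cliffordUnitaries :
    (⟨controlledZ, controlledZ_mem⟩ : U4) ∈ cliffordUnitaries := by
  apply mem_cliffordUnitaries
  · apply Subtype.ext
    rw [SubmonoidClass.coe_pow]
    change controlledZ ^ 4 = 1
    rw [show 4 = 2 * 2 from rfl, pow_mul, pow_two controlledZ, controlledZ_sq, one_pow]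
  · rintro s ⟨α, hα, β, hβ, hs⟩
    have key : ∃ k : ℕ, ∃ α' ∈ pauliOne, ∃ β' ∈ pauliOne,
        controlledZ * (α ⊗ₖ β) * controlledZ = Complex.I ^ k • (α' ⊗ₖ β') := by
      have e (k : ℕ) (α' β' : Matrix (Fin 2) (Fin 2) ℂ) (hα' : α' ∈ pauliOne)
          (hβ' : β' ∈ pauliOne) (h : ∀ i j k' l : Fin 2,
            (if (i, j) = ((1, 1) : Fin 2 × Fin 2) then (-1 : ℂ) else 1) * (α i k' * β j l) *
            (if (k', l) = ((1, 1) : Fin 2 × Fin 2) then (-1 : ℂ) else 1) =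
              Complex.I ^ k * (α' i k' * β' j l)) :
          ∃ k : ℕ, ∃ α' ∈ pauliOne, ∃ β' ∈ pauliOne,
            controlledZ * (α ⊗ₖ β) * controlledZ = Complex.I ^ k • (α' ⊗ₖ β') := by
        refine ⟨k, α', hα', β', hβ', ?_⟩
        rw [controlledZ_eq]
        ext ⟨i, j⟩ ⟨k', l⟩
        rw [Matrix.mul_diagonal, Matrix.diagonal_mul]
        exact h i j k' l
      rcases hα with rfl | rfl | rfl | rfl <;> rcases hβ with rfl | rfl | rfl | rfl
      · refine e 0 1 1 one_mem_pauliOne one_mem_pauliOne ?_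
        simp [Fin.forall_fin_two]
      · refine e 0 pauliZ pauliX pauliZ_mem pauliX_mem ?_
        simp [Fin.forall_fin_two, pauliX, pauliZ]
      · refine e 0 pauliZ pauliY pauliZ_mem pauliY_mem ?_
        simp [Fin.forall_fin_two, pauliY, pauliZ]
      · refine e 0 1 pauliZ one_mem_pauliOne pauliZ_mem ?_
        simp [Fin.forall_fin_two, pauliZ]
      · refine e 0 pauliX pauliZ pauliX_mem pauliZ_mem ?_
        simp [Fin.forall_fin_two, pauliX, pauliZ]
      · refine e 0 pauliY pauliY pauliY_mem pauliY_mem ?_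
        simp [Fin.forall_fin_two, pauliX, pauliY]
      · refine e 2 pauliY pauliX pauliY_mem pauliX_mem ?_
        simp [Fin.forall_fin_two, pauliX, pauliY]
      · refine e 0 pauliX 1 pauliX_mem one_mem_pauliOne ?_
        simp [Fin.forall_fin_two, pauliX, pauliZ]
      · refine e 0 pauliY pauliZ pauliY_mem pauliZ_mem ?_
        simp [Fin.forall_fin_two, pauliY, pauliZ]
      · refine e 2 pauliX pauliY pauliX_mem pauliY_mem ?_
        simp [Fin.forall_fin_two, pauliX, pauliY]
      · refine e 0 pauliX pauliX pauliX_mem pauliX_mem ?_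
        simp [Fin.forall_fin_two, pauliX, pauliY]
      · refine e 0 pauliY 1 pauliY_mem one_mem_pauliOne ?_
        simp [Fin.forall_fin_two, pauliY, pauliZ]
      · refine e 0 pauliZ 1 pauliZ_mem one_mem_pauliOne ?_
        simp [Fin.forall_fin_two, pauliZ]
      · refine e 0 1 pauliX one_mem_pauliOne pauliX_mem ?_
        simp [Fin.forall_fin_two, pauliX, pauliZ]
      · refine e 0 1 pauliY one_mem_pauliOne pauliY_mem ?_
        simp [Fin.forall_fin_two, pauliY, pauliZ]
      · refine e 0 pauliZ pauliZ pauliZ_mem pauliZ_mem ?_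
        simp [Fin.forall_fin_two, pauliZ]
    obtain ⟨k, α', hα', β', hβ', h⟩ := key
    refine mem_pauliGroup_of_eq k hα' hβ' ?_
    rw [Matrix.UnitaryGroup.mul_val, Matrix.UnitaryGroup.mul_val, Matrix.UnitaryGroup.inv_val, hs]
    rw [← h]
    change controlledZ * (α ⊗ₖ β) * star controlledZ = _
    rw [star_controlledZ]

lemma one_mem_U2 : (1 : Matrix (Fin 2) (Fin 2) ℂ) ∈ Matrix.unitaryGroup (Fin 2) ℂ := one_mem _

/-! ## The generators of the Clifford group -/

/-- `H ⊗ 1`, up to global phase. -/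
def H₁ : C2 := QuotientGroup.mk ⟨tensor hadamard 1 hadamard_mem one_mem_U2,
  tensor_mem_cliffordUnitaries _ _ hadamard_pow_four (one_pow 4)
    preservesPauli_hadamard preservesPauli_one⟩

/-- `1 ⊗ H`, up to global phase. -/
def H₂ : C2 := QuotientGroup.mk ⟨tensor 1 hadamard one_mem_U2 hadamard_mem,
  tensor_mem_cliffordUnitaries _ _ (one_pow 4) hadamard_pow_four
    preservesPauli_one preservesPauli_hadamard⟩

/-- `P ⊗ 1`, up to global phase. -/
def P₁ : C2 := QuotientGroup.mk ⟨tensor phaseGate 1 phaseGate_mem one_mem_U2,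
  tensor_mem_cliffordUnitaries _ _ phaseGate_pow_four (one_pow 4)
    preservesPauli_phaseGate preservesPauli_one⟩

/-- `1 ⊗ P`, up to global phase. -/
def P₂ : C2 := QuotientGroup.mk ⟨tensor 1 phaseGate one_mem_U2 phaseGate_mem,
  tensor_mem_cliffordUnitaries _ _ (one_pow 4) phaseGate_pow_four
    preservesPauli_one preservesPauli_phaseGate⟩

/-- The controlled-`Z` gate, up to global phase. -/
def CZ : C2 := QuotientGroup.mk ⟨⟨controlledZ, controlledZ_mem⟩, controlledZ_mem_cliffordUnitaries⟩

/-! ## Conjugacy classes and the character table -/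

/-- The representatives of the conjugacy classes; class No. `j` has index `j - 1`. -/
def classRep : Fin 21 → C2 :=
  ![1, P₂ * P₁ * H₂ * H₁, CZ, CZ * H₂ * H₁, P₁ ^ 2, P₂ * P₁, CZ * H₁, P₁, P₂ * H₁,
    H₂ * P₂ ^ 2 * H₂ * CZ, P₂ * P₁ ^ 2, H₁, P₁ * H₁, P₂ ^ 2 * P₁ * H₁, P₂ * P₁ * H₁,
    CZ * P₁ * H₂ * H₁, H₂ * H₁, H₁ * H₂ * P₂ * P₁⁻¹ * CZ * H₁ * H₂ * CZ, P₁ * H₂ * H₁,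
    H₁ * CZ * H₂ * P₂ * CZ, CZ * P₂ * H₁]

/-- The sizes of the conjugacy classes. -/
def classSize : Fin 21 → ℕ :=
  ![1, 640, 60, 1920, 15, 180, 720, 30, 360, 180, 90,
    120, 160, 480, 960, 2304, 180, 720, 960, 720, 720]

/-- The character table; rows are the characters `χ₁, …, χ₂₁` and columns the classes. -/
def charTable : Fin 21 → Fin 21 → ℤ :=
  ![
    ![1, 1, 1, 1, 1, 1, 1, 1, 1, 1, 1, 1, 1, 1, 1, 1, 1, 1, 1, 1, 1],
    ![1, 1, -1, -1, 1, 1, 1, -1, 1, -1, -1, -1, 1, 1, -1, 1, 1, 1, -1, -1, -1],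
    ![5, -1, -1, -1, 5, 1, -1, 3, 1, -1, 3, 3, 2, 2, 0, 0, 1, -1, 0, 1, 1],
    ![5, -1, 1, 1, 5, 1, -1, -3, 1, 1, -3, -3, 2, 2, 0, 0, 1, -1, 0, -1, -1],
    ![5, 2, -3, 0, 5, 1, -1, 1, 1, -3, 1, 1, -1, -1, 1, 0, 1, -1, 1, -1, -1],
    ![5, 2, 3, 0, 5, 1, -1, -1, 1, 3, -1, -1, -1, -1, -1, 0, 1, -1, -1, 1, 1],
    ![9, 0, -3, 0, 9, 1, 1, -3, 1, -3, -3, -3, 0, 0, 0, -1, 1, 1, 0, 1, 1],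
    ![9, 0, 3, 0, 9, 1, 1, 3, 1, 3, 3, 3, 0, 0, 0, -1, 1, 1, 0, -1, -1],
    ![10, 1, -2, 1, 10, -2, 0, 2, -2, -2, 2, 2, 1, 1, -1, 0, -2, 0, -1, 0, 0],
    ![10, 1, 2, -1, 10, -2, 0, -2, -2, 2, -2, -2, 1, 1, 1, 0, -2, 0, 1, 0, 0],
    ![15, 0, 3, 0, -1, -1, -1, -5, -1, -1, 3, -1, 3, -1, 1, 0, 3, 1, -1, 1, -1],
    ![15, 0, -3, 0, -1, 3, 1, -7, -1, 1, 1, 1, 3, -1, -1, 0, -1, -1, 1, 1, -1],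
    ![15, 0, -3, 0, -1, -1, -1, 5, -1, 1, -3, 1, 3, -1, -1, 0, 3, 1, 1, -1, 1],
    ![15, 0, 3, 0, -1, 3, 1, 7, -1, -1, -1, -1, 3, -1, 1, 0, -1, -1, -1, -1, 1],
    ![16, -2, 0, 0, 16, 0, 0, 0, 0, 0, 0, 0, -2, -2, 0, 1, 0, 0, 0, 0, 0],
    ![30, 0, -6, 0, -2, 2, 0, -2, -2, 2, -2, 2, -3, 1, 1, 0, 2, 0, -1, 0, 0],
    ![30, 0, 6, 0, -2, 2, 0, 2, -2, -2, 2, -2, -3, 1, -1, 0, 2, 0, 1, 0, 0],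
    ![45, 0, -3, 0, -3, 1, -1, 9, 1, 1, 1, -3, 0, 0, 0, 0, -3, 1, 0, 1, -1],
    ![45, 0, 3, 0, -3, 1, -1, -9, 1, -1, -1, 3, 0, 0, 0, 0, -3, 1, 0, -1, 1],
    ![45, 0, -3, 0, -3, -3, 1, -3, 1, 1, 5, -3, 0, 0, 0, 0, 1, -1, 0, -1, 1],
    ![45, 0, 3, 0, -3, -3, 1, 3, 1, -1, -5, 3, 0, 0, 0, 0, 1, -1, 0, 1, -1]]

/-- `χ` is the character of a finite-dimensional irreducible complex representation of `G`. -/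
def IsIrreducibleCharacter {G : Type} [Group G] (χ : G → ℂ) : Prop :=
  ∃ (V : Type) (_ : AddCommGroup V) (_ : Module ℂ V) (_ : FiniteDimensional ℂ V)
    (ρ : Representation ℂ G V), ρ.IsIrreducible ∧ ρ.character = χ

/-! ## The matrix representation -/

/-- The action of the Clifford unitaries on the complex 4 by 4 matrices by conjugation. -/
def conjRep : Representation ℂ cliffordUnitaries (Matrix (Fin 2 × Fin 2) (Fin 2 × Fin 2) ℂ) where
  toFun A :=
    { toFun := fun M => A.1.1 * M * (A⁻¹).1.1
      map_add' := fun M N => by rw [mul_add, add_mul]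
      map_smul' := fun c M => by simp }
  map_one' := by
    ext1 M
    simp
  map_mul' A B := by
    apply LinearMap.ext
    intro M
    simp [mul_assoc]

/-- The matrix representation `M ↦ A M A⁻¹` of the two-qubit Clifford group on the complex
4 by 4 matrices. -/
def matrixRep : Representation ℂ C2 (Matrix (Fin 2 × Fin 2) (Fin 2 × Fin 2) ℂ) :=
  QuotientGroup.lift globalPhase conjRep (by
    rintro A ⟨c, hc⟩
    apply LinearMap.ext
    intro M
    have hA : (A.1 : Matrix (Fin 2 × Fin 2) (Fin 2 × Fin 2) ℂ) * (A⁻¹).1.1 = 1 :=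
      congrArg (fun B : cliffordUnitaries => B.1.1) (mul_inv_cancel A)
    change A.1.1 * M * (A⁻¹).1.1 = M
    have hcM : A.1.1 * M = M * A.1.1 := by simp [hc]
    rw [hcM, mul_assoc, hA, mul_one])

end Clifford

end

/-! The Clifford group permutes the 32 signed Pauli matrices `±σ ⊗ τ` by conjugation: a conjugate of
a Pauli matrix lies in the Pauli group and squares to 1, so its phase is a sign. An element fixing
`X ⊗ 1`, `Z ⊗ 1`, `1 ⊗ X` and `1 ⊗ Z` commutes with all matrices, so it is a phase
(`eq_one_of_fixed`). A stabilizer chain along these four base points has orbits of lengths 30, 16,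
6, 4, because conjugation fixes `±1` and preserves commutation relations and explicit words reach
every place so allowed. Hence the order is 30 · 16 · 6 · 4 = 11520, and each element is a unique
product of four listed words (`element_bijective`). Encoding a self-map of the 32 places as one
number in base 32 reduces questions about the group to integer arithmetic.

The characters come from four actions: the sign and the fixed points of the permutation of the six
maximal anticommuting sets (the quotient by the Pauli matrices is Sp(4,2) ≅ S₆), the matrix
representation, and the fixed points on flags. Virtual characters form a ring, so the 21 integer
polynomials of `charPolynomial` in these are virtual characters. Their values on the representatives
form the table. A virtual character of norm one and positive degree is irreducible
(`isIrreducibleCharacter_of_norm_one`).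

For the classes, distinct columns of the table show that the representatives are pairwise
non-conjugate. Upper bounds for the centralizers give lower bounds for the class sizes. These add up
to 11520 already, so every bound is an equality and no class is missing. Norms are then weighted
sums over the columns. The list of characters is complete because the sum of `χᵢ(1) χᵢ` vanishes off
the identity: an irreducible character orthogonal to all `χᵢ` would have degree 0. -/

noncomputable section

namespace Clifford

/-! ## Virtual characters of a finite group -/

section VirtualCharacters

variable {G : Type} [Group G]

lemma character_eq_add_of_isCompl {V : Type} [AddCommGroup V] [Module ℂ V] [FiniteDimensional ℂ V]
    (ρ : Representation ℂ G V) {p q : Subrepresentation ρ} (h : IsCompl p q) :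
    ρ.character = p.toRepresentation.character + q.toRepresentation.character := by
  have h' : IsCompl p.toSubmodule q.toSubmodule := by
    refine ⟨disjoint_iff.2 ?_, codisjoint_iff.2 ?_⟩
    · exact congrArg Subrepresentation.toSubmodule h.inf_eq_bot
    · exact congrArg Subrepresentation.toSubmodule h.sup_eq_top
  ext g
  simp only [Representation.character, Pi.add_apply]
  rw [← LinearMap.trace_prodMap',
    ← LinearMap.trace_conj' _ (Submodule.prodEquivOfIsCompl _ _ h')]
  congr 1
  ext v
  obtain ⟨⟨x, y⟩, rfl⟩ := (Submodule.prodEquivOfIsCompl _ _ h').surjective v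
  rw [LinearEquiv.conj_apply_apply, LinearEquiv.symm_apply_apply, LinearMap.prodMap_apply]
  simp only [Submodule.coe_prodEquivOfIsCompl', map_add]
  rfl

/-- The `ℤ`-span of the irreducible characters. -/
def virtualCharacters (G : Type) [Group G] : Submodule ℤ (G → ℂ) :=
  Submodule.span ℤ {ψ | IsIrreducibleCharacter ψ}

/-- Induction on the dimension: by Maschke's theorem a proper nonzero subrepresentation has a
complement, and the character is the sum of two characters of smaller degree. -/
lemma character_mem_virtualCharacters [Finite G] {V : Type} [AddCommGroup V] [Module ℂ V]
    [FiniteDimensional ℂ V] (ρ : Representation ℂ G V) : ρ.character ∈ virtualCharacters G := by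
  induction hn : Module.finrank ℂ V using Nat.strong_induction_on generalizing V with
  | _ n ih =>
  by_cases hirr : ρ.IsIrreducible
  · exact Submodule.subset_span ⟨V, _, _, inferInstance, ρ, hirr, rfl⟩
  by_cases hV : Subsingleton V
  · have : ρ.character = 0 := by
      ext g
      have : ρ g = 0 := Subsingleton.elim _ _
      simp [Representation.character, this]
    rw [this]
    exact zero_mem _
  have : Nontrivial V := not_subsingleton_iff_nontrivial.1 hV
  have hnt : Nontrivial (Subrepresentation ρ) := by
    refine ⟨⊥, ⊤, fun h => ?_⟩
    exact bot_ne_top (α := Submodule ℂ V) (congrArg Subrepresentation.toSubmodule h)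
  obtain ⟨p, hp0, hp1⟩ : ∃ p : Subrepresentation ρ, p ≠ ⊥ ∧ p ≠ ⊤ := by
    by_contra! hcon
    exact hirr { eq_bot_or_eq_top := fun p => or_iff_not_imp_left.2 (hcon p) }
  obtain ⟨q, hpq⟩ := exists_isCompl p
  have hq1 : q ≠ ⊤ := fun h => hp0 (by simpa [h] using hpq.inf_eq_bot)
  have lt {r : Subrepresentation ρ} (hr : r ≠ ⊤) : Module.finrank ℂ r.toSubmodule < n := by
    rw [← hn]
    exact Submodule.finrank_lt fun h => hr (Subrepresentation.toSubmodule_injective h)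
  rw [character_eq_add_of_isCompl ρ hpq]
  exact add_mem (ih _ (lt hp1) _ rfl) (ih _ (lt hq1) _ rfl)

lemma one_mem_virtualCharacters [Finite G] : (1 : G → ℂ) ∈ virtualCharacters G := by
  have h := character_mem_virtualCharacters (Representation.trivial ℂ G ℂ)
  convert h using 1
  ext g
  simp [Representation.character]

/-- By bilinearity it suffices to multiply two irreducible characters, whose product is the
character of the tensor product. -/
lemma mul_mem_virtualCharacters [Finite G] {f g : G → ℂ} (hf : f ∈ virtualCharacters G)
    (hg : g ∈ virtualCharacters G) : f * g ∈ virtualCharacters G := by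
  induction hf using Submodule.span_induction with
  | zero => simp
  | add x y _ _ hx hy => rw [add_mul]; exact add_mem hx hy
  | smul a x _ hx => rw [smul_mul_assoc]; exact Submodule.smul_mem _ _ hx
  | mem ψ hψ =>
    induction hg using Submodule.span_induction with
    | zero => simp
    | add x y _ _ hx hy => rw [mul_add]; exact add_mem hx hy
    | smul a x _ hx => rw [mul_smul_comm]; exact Submodule.smul_mem _ _ hx
    | mem φ hφ =>
      obtain ⟨V, _, _, _, ρ, -, rfl⟩ := hψ
      obtain ⟨W, _, _, _, σ, -, rfl⟩ := hφ
      rw [← Representation.char_tensor]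
      exact character_mem_virtualCharacters _

/-- The ring of virtual characters. -/
def virtualCharacterRing (G : Type) [Group G] [Finite G] : Subring (G → ℂ) where
  __ := (virtualCharacters G).toAddSubgroup
  one_mem' := one_mem_virtualCharacters
  mul_mem' := mul_mem_virtualCharacters

lemma apply_conj_of_mem_virtualCharacters {f : G → ℂ} (hf : f ∈ virtualCharacters G) {g h : G}
    (hgh : IsConj g h) : f g = f h := by
  induction hf using Submodule.span_induction with
  | zero => rfl
  | add x y _ _ hx hy => simp [hx, hy]
  | smul a x _ hx => simp [hx]
  | mem ψ hψ =>
    obtain ⟨V, _, _, _, ρ, -, rfl⟩ := hψ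
    obtain ⟨c, rfl⟩ := isConj_iff.1 hgh
    simp

/-- The bilinear form `⟨f, h⟩ = |G|⁻¹ ∑ f(g) h(g⁻¹)` on functions on a finite group. -/
def charInner [Fintype G] (f h : G → ℂ) : ℂ := (Nat.card G : ℂ)⁻¹ * ∑ g, f g * h g⁻¹

lemma charInner_sum_left [Fintype G] {ι : Type*} (s : Finset ι) (f : ι → G → ℂ) (h : G → ℂ) :
    charInner (∑ i ∈ s, f i) h = ∑ i ∈ s, charInner (f i) h := by
  simp only [charInner, Finset.sum_apply, Finset.sum_mul, ← Finset.mul_sum]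
  rw [Finset.sum_comm]

lemma charInner_sum_right [Fintype G] {ι : Type*} (s : Finset ι) (f : G → ℂ) (h : ι → G → ℂ) :
    charInner f (∑ i ∈ s, h i) = ∑ i ∈ s, charInner f (h i) := by
  simp only [charInner, Finset.sum_apply, Finset.mul_sum]
  rw [Finset.sum_comm]

lemma charInner_smul_smul [Fintype G] (a b : ℤ) (f h : G → ℂ) :
    charInner (a • f) (b • h) = a * b * charInner f h := by
  simp only [charInner, Pi.smul_apply, zsmul_eq_mul, Finset.mul_sum]
  exact Finset.sum_congr rfl fun g _ => by ring

lemma charInner_irreducible [Fintype G] {ψ φ : G → ℂ} (hψ : IsIrreducibleCharacter ψ)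
    (hφ : IsIrreducibleCharacter φ) [Decidable (ψ = φ)] :
    charInner ψ φ = if ψ = φ then 1 else 0 := by
  classical
  have : Invertible (Nat.card G : ℂ) := invertibleOfNonzero (by simp)
  split_ifs with h
  · subst h
    obtain ⟨V, _, _, _, ρ, hρ, rfl⟩ := hψ
    rw [charInner, Representation.char_orthonormal, if_pos ⟨Representation.Equiv.refl ρ⟩]
  · obtain ⟨V, _, _, _, ρ, hρ, rfl⟩ := hψ
    obtain ⟨W, _, _, _, σ, hσ, rfl⟩ := hφ
    rw [charInner, Representation.char_orthonormal, if_neg]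
    rintro ⟨e⟩
    exact h (Representation.char_iso e).symm

lemma IsIrreducibleCharacter.apply_one_pos {ψ : G → ℂ} (hψ : IsIrreducibleCharacter ψ) :
    ∃ n : ℕ, 0 < n ∧ ψ 1 = n := by
  obtain ⟨V, _, _, _, ρ, hρ, rfl⟩ := hψ
  refine ⟨_, ?_, Representation.char_one ρ⟩
  rw [Module.finrank_pos_iff]
  by_contra hV
  rw [not_nontrivial_iff_subsingleton] at hV
  obtain ⟨p, q, hpq⟩ := hρ.toNontrivial
  exact hpq (Subrepresentation.toSubmodule_injective (Subsingleton.elim _ _))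

/-- A virtual character of norm one and positive degree is irreducible. -/
theorem isIrreducibleCharacter_of_norm_one [Fintype G] {f : G → ℂ}
    (hf : f ∈ virtualCharacters G) (hn : charInner f f = 1) {d : ℕ} (hd : f 1 = d) :
    IsIrreducibleCharacter f := by
  classical
  obtain ⟨n, rfl⟩ := (Finsupp.mem_span_iff_linearCombination ℤ _ _).1 hf
  rw [Finsupp.linearCombination_apply, Finsupp.sum] at hn hd ⊢
  -- Orthonormality of the irreducible characters turns the norm into the sum of the squared
  -- coefficients.
  have h1 : ∑ ψ ∈ n.support, n ψ * n ψ = 1 := by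
    have : ((∑ ψ ∈ n.support, n ψ * n ψ : ℤ) : ℂ) = 1 := by
      rw [← hn, charInner_sum_left, Int.cast_sum]
      refine Finset.sum_congr rfl fun ψ hψ => ?_
      rw [charInner_sum_right, Finset.sum_eq_single ψ]
      · rw [charInner_smul_smul, charInner_irreducible ψ.2 ψ.2]
        simp
      · intro φ _ hφ
        rw [charInner_smul_smul, charInner_irreducible ψ.2 φ.2, if_neg, mul_zero]
        exact fun h => hφ (Subtype.ext h.symm)
      · exact fun h => absurd hψ h
    exact_mod_cast this
  obtain ⟨ψ, hψ⟩ : n.support.Nonempty := by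
    rw [Finset.nonempty_iff_ne_empty]
    intro h
    simp [h] at h1
  have hpos : ∀ φ ∈ n.support, 0 < n φ * n φ := fun φ hφ =>
    mul_self_pos.2 (Finsupp.mem_support_iff.1 hφ)
  have hsupp : n.support = {ψ} := by
    rw [Finset.eq_singleton_iff_unique_mem]
    refine ⟨hψ, fun φ hφ => ?_⟩
    by_contra hne
    -- Two nonzero integer coefficients would contribute at least 2.
    have h2 : n ψ * n ψ + n φ * n φ ≤ 1 := by
      rw [← h1, ← Finset.sum_pair (f := fun χ => n χ * n χ) (Ne.symm hne)]
      refine Finset.sum_le_sum_of_subset_of_nonneg ?_ fun χ _ _ => mul_self_nonneg _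
      intro χ hχ
      rcases Finset.mem_insert.1 hχ with rfl | hχ
      · exact hψ
      · rwa [Finset.mem_singleton.1 hχ]
    have := hpos ψ hψ
    have := hpos φ hφ
    omega
  rw [hsupp, Finset.sum_singleton] at h1 hd ⊢
  obtain ⟨k, hk, hk1⟩ := ψ.2.apply_one_pos
  -- The remaining coefficient is 1 or -1; the value -1 would make the degree negative.
  have hnψ : n ψ = 1 := by
    have h2 : n ψ * k = d := by
      rw [Pi.smul_apply, hk1, zsmul_eq_mul] at hd
      exact_mod_cast hd
    rcases mul_self_eq_one_iff.1 h1 with h | h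
    · exact h
    · rw [h] at h2
      omega
  rw [hnψ, one_smul]
  exact ψ.2

/-- A monomial matrix has nonzero diagonal entries only at fixed indices. Both permutation
representations and the signed action on Pauli matrices have this shape. -/
lemma trace_eq_sum_of_monomial {V ι : Type*} [AddCommGroup V] [Module ℂ V] [Fintype ι]
    [DecidableEq ι] (b : Module.Basis ι ℂ V) (f : V →ₗ[ℂ] V) (σ : ι → ι) (c : ι → ℂ)
    (h : ∀ i, f (b i) = c i • b (σ i)) :
    LinearMap.trace ℂ V f = ∑ i, if σ i = i then c i else 0 := by
  rw [LinearMap.trace_eq_matrix_trace ℂ b, Matrix.trace]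
  refine Finset.sum_congr rfl fun i _ => ?_
  rw [Matrix.diag_apply, LinearMap.toMatrix_apply, h]
  simp [Finsupp.single_apply]

/-- The permutation representation of an action on a finite set. -/
def permRep {X : Type} (f : G →* Equiv.Perm X) : Representation ℂ G (X → ℂ) where
  -- Pulling functions back is contravariant; the inverse restores a left action.
  toFun g := LinearMap.funLeft ℂ ℂ (f g⁻¹)
  map_one' := by ext; simp
  map_mul' g h := by
    apply LinearMap.ext
    intro v
    ext x
    simp [LinearMap.funLeft_apply]

/-- The number of fixed points of a permutation action is a character. -/
lemma fixedPoints_mem_virtualCharacters [Finite G] {X : Type} [Fintype X] [DecidableEq X]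
    (f : G →* Equiv.Perm X) :
    (fun g => ((Finset.univ.filter fun x => f g x = x).card : ℂ)) ∈ virtualCharacters G := by
  have h := character_mem_virtualCharacters (permRep f)
  convert h using 1
  ext g
  rw [Representation.character, trace_eq_sum_of_monomial (Pi.basisFun ℂ X) _ (f g) fun _ => 1]
  · simp
  · intro x
    ext y
    simp [permRep, LinearMap.funLeft_apply, Pi.single_apply, Equiv.symm_apply_eq]

/-- A homomorphism to `{±1}` is a character. -/
lemma sign_mem_virtualCharacters [Finite G] (f : G →* ℤˣ) :
    (fun g => ((f g : ℤ) : ℂ)) ∈ virtualCharacters G := by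
  let ρ : Representation ℂ G ℂ :=
    { toFun := fun g => ((f g : ℤ) : ℂ) • LinearMap.id
      map_one' := by ext; simp
      map_mul' := fun g h => by ext; simp [mul_comm] }
  have h := character_mem_virtualCharacters ρ
  convert h using 1
  ext g
  simp [Representation.character, ρ]

end VirtualCharacters

/-! ## The signed Pauli matrices -/

/-- The one-qubit Pauli matrices `1, X, Y, Z`, numbered from `0` to `3`. -/
def pauli : ℕ → Matrix (Fin 2) (Fin 2) ℂ
  | 0 => 1
  | 1 => pauliX
  | 2 => pauliY
  | _ => pauliZ

/-- The signed Pauli matrix `(-1)ᵘ σ_a ⊗ σ_b` has number `16 u + 4 a + b`. -/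
def signedPauli (s : ℕ) : Matrix (Fin 2 × Fin 2) (Fin 2 × Fin 2) ℂ :=
  (-1 : ℂ) ^ (s / 16) • (pauli (s / 4 % 4) ⊗ₖ pauli (s % 4))

lemma signedPauli_eq (u : ℕ) {a b : ℕ} (ha : a < 4) (hb : b < 4) :
    signedPauli (16 * (u % 2) + 4 * a + b) = (-1 : ℂ) ^ u • (pauli a ⊗ₖ pauli b) := by
  have h1 : (16 * (u % 2) + 4 * a + b) / 16 = u % 2 := by omega
  have h2 : (16 * (u % 2) + 4 * a + b) / 4 % 4 = a := by omega
  have h3 : (16 * (u % 2) + 4 * a + b) % 4 = b := by omega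
  rw [signedPauli, h1, h2, h3, neg_one_pow_eq_pow_mod_two (R := ℂ) u]

lemma pauli_mem (a : ℕ) : pauli a ∈ pauliOne := by
  match a with
  | 0 => exact one_mem_pauliOne
  | 1 => exact pauliX_mem
  | 2 => exact pauliY_mem
  | n + 3 => exact pauliZ_mem

lemma exists_pauli_eq {σ : Matrix (Fin 2) (Fin 2) ℂ} (hσ : σ ∈ pauliOne) :
    ∃ a < 4, σ = pauli a := by
  rcases hσ with rfl | rfl | rfl | rfl
  exacts [⟨0, by norm_num, rfl⟩, ⟨1, by norm_num, rfl⟩, ⟨2, by norm_num, rfl⟩,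
    ⟨3, by norm_num, rfl⟩]

lemma pauli_mul_self (a : ℕ) : pauli a * pauli a = 1 := by
  match a with
  | 0 => exact one_mul 1
  | 1 => simp [pauli, pauliX, Matrix.one_fin_two]
  | 2 => simp [pauli, pauliY, Matrix.one_fin_two]
  | n + 3 => simp [pauli, pauliZ, Matrix.one_fin_two]

lemma pauliX_mul_pauliY : pauliX * pauliY = Complex.I • pauliZ := by
  simp [pauliX, pauliY, pauliZ]

lemma pauliY_mul_pauliZ : pauliY * pauliZ = Complex.I • pauliX := by
  simp [pauliX, pauliY, pauliZ]

lemma pauliZ_mul_pauliX : pauliZ * pauliX = Complex.I • pauliY := by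
  simp [pauliX, pauliY, pauliZ]

lemma pauliY_mul_pauliX : pauliY * pauliX = Complex.I ^ 3 • pauliZ := by
  simp [pauliX, pauliY, pauliZ, Complex.I_pow_three]

lemma pauliZ_mul_pauliY : pauliZ * pauliY = Complex.I ^ 3 • pauliX := by
  simp [pauliX, pauliY, pauliZ, Complex.I_pow_three]

lemma pauliX_mul_pauliZ : pauliX * pauliZ = Complex.I ^ 3 • pauliY := by
  simp [pauliX, pauliY, pauliZ, Complex.I_pow_three]

lemma exists_mul_eq_of_mem_pauliOne {σ τ : Matrix (Fin 2) (Fin 2) ℂ} (hσ : σ ∈ pauliOne)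
    (hτ : τ ∈ pauliOne) : ∃ k : ℕ, ∃ ρ ∈ pauliOne, σ * τ = Complex.I ^ k • ρ := by
  rcases hσ with rfl | rfl | rfl | rfl
  · exact ⟨0, τ, hτ, by simp⟩
  · rcases hτ with rfl | rfl | rfl | rfl
    · exact ⟨0, _, pauliX_mem, by simp⟩
    · exact ⟨0, _, one_mem_pauliOne, by rw [pow_zero, one_smul]; exact pauli_mul_self 1⟩
    · exact ⟨1, _, pauliZ_mem, by simpa using pauliX_mul_pauliY⟩
    · exact ⟨3, _, pauliY_mem, pauliX_mul_pauliZ⟩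
  · rcases hτ with rfl | rfl | rfl | rfl
    · exact ⟨0, _, pauliY_mem, by simp⟩
    · exact ⟨3, _, pauliZ_mem, pauliY_mul_pauliX⟩
    · exact ⟨0, _, one_mem_pauliOne, by rw [pow_zero, one_smul]; exact pauli_mul_self 2⟩
    · exact ⟨1, _, pauliX_mem, by simpa using pauliY_mul_pauliZ⟩
  · rcases hτ with rfl | rfl | rfl | rfl
    · exact ⟨0, _, pauliZ_mem, by simp⟩
    · exact ⟨1, _, pauliY_mem, by simpa using pauliZ_mul_pauliX⟩
    · exact ⟨3, _, pauliX_mem, pauliZ_mul_pauliY⟩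
    · exact ⟨0, _, one_mem_pauliOne, by rw [pow_zero, one_smul]; exact pauli_mul_self 3⟩

/-- The elements of the Pauli group are the Pauli matrices up to a power of `i`. -/
lemma exists_of_mem_pauliGroup {A : U4} (hA : A ∈ pauliGroup) :
    ∃ k : ℕ, ∃ σ ∈ pauliOne, ∃ τ ∈ pauliOne,
      (A : Matrix (Fin 2 × Fin 2) (Fin 2 × Fin 2) ℂ) = Complex.I ^ k • (σ ⊗ₖ τ) := by
  have hmul : ∀ A B : U4,
      (∃ k : ℕ, ∃ σ ∈ pauliOne, ∃ τ ∈ pauliOne,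
        (A : Matrix (Fin 2 × Fin 2) (Fin 2 × Fin 2) ℂ) = Complex.I ^ k • (σ ⊗ₖ τ)) →
      (∃ k : ℕ, ∃ σ ∈ pauliOne, ∃ τ ∈ pauliOne,
        (B : Matrix (Fin 2 × Fin 2) (Fin 2 × Fin 2) ℂ) = Complex.I ^ k • (σ ⊗ₖ τ)) →
      ∃ k : ℕ, ∃ σ ∈ pauliOne, ∃ τ ∈ pauliOne,
        ((A * B : U4) : Matrix (Fin 2 × Fin 2) (Fin 2 × Fin 2) ℂ) =
          Complex.I ^ k • (σ ⊗ₖ τ) := by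
    rintro A B ⟨k, σ, hσ, τ, hτ, hA⟩ ⟨l, σ', hσ', τ', hτ', hB⟩
    obtain ⟨m, α, hα, e⟩ := exists_mul_eq_of_mem_pauliOne hσ hσ'
    obtain ⟨n, β, hβ, e'⟩ := exists_mul_eq_of_mem_pauliOne hτ hτ'
    refine ⟨k + l + (m + n), α, hα, β, hβ, ?_⟩
    rw [Matrix.UnitaryGroup.mul_val, hA, hB, Matrix.smul_mul, Matrix.mul_smul, smul_smul,
      ← Matrix.mul_kronecker_mul, e, e', Matrix.smul_kronecker, Matrix.kronecker_smul, smul_smul,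
      smul_smul, ← pow_add, ← pow_add, ← pow_add, add_assoc]
  have hinv : ∀ A : U4, A ∈ pauliTwo → A⁻¹ = A := by
    rintro A ⟨σ, hσ, τ, hτ, hA⟩
    obtain ⟨a, -, rfl⟩ := exists_pauli_eq hσ
    obtain ⟨b, -, rfl⟩ := exists_pauli_eq hτ
    rw [inv_eq_iff_mul_eq_one]
    apply Subtype.ext
    rw [Matrix.UnitaryGroup.mul_val, hA, ← Matrix.mul_kronecker_mul, pauli_mul_self,
      pauli_mul_self]
    simp
  have hgen : ∀ A : U4, A ∈ pauliTwo → ∃ k : ℕ, ∃ σ ∈ pauliOne, ∃ τ ∈ pauliOne,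
      (A : Matrix (Fin 2 × Fin 2) (Fin 2 × Fin 2) ℂ) = Complex.I ^ k • (σ ⊗ₖ τ) := by
    rintro A ⟨σ, hσ, τ, hτ, hA⟩
    exact ⟨0, σ, hσ, τ, hτ, by simp [hA]⟩
  induction hA using Subgroup.closure_induction'' with
  | one => exact ⟨0, 1, one_mem_pauliOne, 1, one_mem_pauliOne, by simp⟩
  | mem x hx => exact hgen x hx
  | inv_mem x hx => rw [hinv x hx]; exact hgen x hx
  | mul x y _ _ hx hy => exact hmul x y hx hy

lemma trace_pauli_mul {a b : ℕ} (ha : a < 4) (hb : b < 4) :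
    (pauli a * pauli b).trace = if a = b then 2 else 0 := by
  interval_cases a <;> interval_cases b <;>
    simp [pauli, pauliX, pauliY, pauliZ, Matrix.trace_fin_two, Matrix.one_fin_two] <;> norm_num

/-- Orthogonality of the Pauli matrices under the trace form. It yields both that a number below 32
is determined by its matrix and that the sixteen unsigned matrices are independent. -/
lemma trace_signedPauli_mul (s t : ℕ) :
    (signedPauli s * signedPauli t).trace =
      if s % 16 = t % 16 then (-1) ^ (s / 16 + t / 16) * 4 else 0 := by
  rw [signedPauli, signedPauli, Matrix.smul_mul, Matrix.mul_smul, smul_smul,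
    ← Matrix.mul_kronecker_mul, Matrix.trace_smul, Matrix.trace_kronecker,
    trace_pauli_mul (by omega) (by omega), trace_pauli_mul (by omega) (by omega), ← pow_add]
  have : s % 16 = t % 16 ↔ s / 4 % 4 = t / 4 % 4 ∧ s % 4 = t % 4 := by omega
  simp only [this]
  split_ifs <;> first | (simp; done) | (exfalso; tauto) | (norm_num)

lemma signedPauli_injective : Function.Injective fun s : Fin 32 => signedPauli s := by
  intro s t h
  have h1 := trace_signedPauli_mul s t
  have h2 := trace_signedPauli_mul t t
  simp only at h
  rw [h, h2, if_pos rfl] at h1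
  have h3 : (-1 : ℂ) ^ ((t : ℕ) / 16 + t / 16) = 1 := Even.neg_one_pow ⟨_, rfl⟩
  rw [h3] at h1
  split_ifs at h1 with hst
  · have : (-1 : ℂ) ^ ((s : ℕ) / 16 + t / 16) = 1 := by linear_combination -h1 / 4
    rw [neg_one_pow_eq_one_iff_even (by norm_num)] at this
    ext
    have := s.2
    have := t.2
    rcases ‹Even _› with ⟨r, hr⟩
    omega
  · norm_num at h1

lemma signedPauli_add_sixteen (s : ℕ) : signedPauli (s + 16) = -signedPauli s := by
  have h1 : (s + 16) / 16 = s / 16 + 1 := by omega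
  have h2 : (s + 16) / 4 % 4 = s / 4 % 4 := by omega
  have h3 : (s + 16) % 4 = s % 4 := by omega
  rw [signedPauli, signedPauli, h1, h2, h3, pow_succ]
  simp

lemma signedPauli_zero : signedPauli 0 = 1 := by simp [signedPauli, pauli]

/-! ## The action on the signed Pauli matrices -/

lemma matrixRep_mk (A : cliffordUnitaries) (M : Matrix (Fin 2 × Fin 2) (Fin 2 × Fin 2) ℂ) :
    matrixRep (QuotientGroup.mk A) M = A.1.1 * M * star A.1.1 := rfl

lemma star_mul_self_val (A : cliffordUnitaries) : star A.1.1 * A.1.1 = 1 := A.1.2.1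

lemma matrixRep_mul_matrix (g : C2) (M N : Matrix (Fin 2 × Fin 2) (Fin 2 × Fin 2) ℂ) :
    matrixRep g (M * N) = matrixRep g M * matrixRep g N := by
  obtain ⟨A, rfl⟩ := QuotientGroup.mk_surjective g
  simp only [matrixRep_mk]
  calc A.1.1 * (M * N) * star A.1.1 = A.1.1 * M * 1 * N * star A.1.1 := by
        simp only [mul_assoc, mul_one]
    _ = _ := by rw [← star_mul_self_val A]; simp only [mul_assoc]

lemma matrixRep_one_matrix (g : C2) : matrixRep g 1 = 1 := by
  obtain ⟨A, rfl⟩ := QuotientGroup.mk_surjective g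
  rw [matrixRep_mk, mul_one]
  exact A.1.2.2

/-- Since `σ ⊗ τ` squares to 1, the square of `i ^ k • (σ ⊗ τ)` is `(-1) ^ k`; thus `k` is even and
the phase is a sign. -/
lemma exists_signedPauli_of_sq {A : U4} (hA : A ∈ pauliGroup) (h : A * A = 1) :
    ∃ t : Fin 32, A.1 = signedPauli t := by
  obtain ⟨k, σ, hσ, τ, hτ, e⟩ := exists_of_mem_pauliGroup hA
  obtain ⟨a, ha, rfl⟩ := exists_pauli_eq hσ
  obtain ⟨b, hb, rfl⟩ := exists_pauli_eq hτ
  have h1 : A.1 * A.1 = 1 := congrArg Subtype.val h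
  rw [e, Matrix.smul_mul, Matrix.mul_smul, smul_smul, ← Matrix.mul_kronecker_mul, pauli_mul_self,
    pauli_mul_self, Matrix.one_kronecker_one, ← mul_pow, Complex.I_mul_I] at h1
  have h2 : (-1 : ℂ) ^ k = 1 := by simpa using congrFun (congrFun h1 (0, 0)) (0, 0)
  obtain ⟨u, rfl⟩ := (neg_one_pow_eq_one_iff_even (by norm_num)).1 h2
  refine ⟨⟨16 * (u % 2) + 4 * a + b, by omega⟩, ?_⟩
  rw [e, signedPauli_eq u ha hb, ← two_mul, pow_mul, Complex.I_sq]

/-- The unsigned matrix is a generator of the Pauli group and an involution, and conjugation by a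
normalizing unitary keeps both properties. The sign of `s` is carried along by linearity. -/
lemma exists_matrixRep_signedPauli (g : C2) (s : Fin 32) :
    ∃ t : Fin 32, matrixRep g (signedPauli s) = signedPauli t := by
  obtain ⟨A, rfl⟩ := QuotientGroup.mk_surjective g
  let B : U4 := tensor _ _ (pauliOne_mem (pauli_mem (s / 4 % 4))) (pauliOne_mem (pauli_mem (s % 4)))
  have hB : B ∈ pauliGroup := tensor_mem (pauli_mem _) (pauli_mem _)
  have hB2 : B * B = 1 := by
    apply Subtype.ext
    change pauli _ ⊗ₖ pauli _ * pauli _ ⊗ₖ pauli _ = 1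
    rw [← Matrix.mul_kronecker_mul, pauli_mul_self, pauli_mul_self, Matrix.one_kronecker_one]
  obtain ⟨t, ht⟩ := exists_signedPauli_of_sq
    ((Subgroup.mem_normalizer_iff.1 A.2 B).1 hB) (by simp [mul_assoc, ← mul_assoc B B, hB2])
  have ht' : matrixRep (QuotientGroup.mk A) B.1 = signedPauli t := ht
  refine ⟨⟨16 * ((s / 16 + t / 16) % 2) + 4 * (t / 4 % 4) + t % 4, by omega⟩, ?_⟩
  rw [signedPauli_eq _ (by omega) (by omega)]
  change matrixRep _ ((-1 : ℂ) ^ ((s : ℕ) / 16) • B.1) = _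
  rw [map_smul, ht', signedPauli, smul_smul, pow_add]

/-- The action of the Clifford group on the signed Pauli matrices by conjugation. -/
def pauliAct : C2 →* Equiv.Perm (Fin 32) :=
  -- A homomorphism from a group to the monoid of self-maps takes values in permutations. The chosen
  -- images are compatible because a number is determined by its matrix.
  MonoidHom.toHomPerm
    { toFun := fun g s => (exists_matrixRep_signedPauli g s).choose
      map_one' := by
        funext s
        apply signedPauli_injective
        simp only
        rw [← (exists_matrixRep_signedPauli 1 s).choose_spec, map_one]
        rfl
      map_mul' := fun g h => by
        funext s
        apply signedPauli_injective
        simp only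
        rw [← (exists_matrixRep_signedPauli (g * h) s).choose_spec, map_mul]
        change matrixRep g (matrixRep h _) = _
        rw [(exists_matrixRep_signedPauli h s).choose_spec,
          (exists_matrixRep_signedPauli g _).choose_spec]
        rfl }

lemma matrixRep_signedPauli (g : C2) (s : Fin 32) :
    matrixRep g (signedPauli s) = signedPauli (pauliAct g s) :=
  (exists_matrixRep_signedPauli g s).choose_spec

lemma pauliAct_eq {g : C2} {s t : Fin 32} (h : matrixRep g (signedPauli s) = signedPauli t) :
    pauliAct g s = t :=
  signedPauli_injective ((matrixRep_signedPauli g s).symm.trans h)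

lemma pauliAct_zero (g : C2) : pauliAct g 0 = 0 := by
  apply pauliAct_eq
  change matrixRep g (signedPauli 0) = signedPauli 0
  rw [signedPauli_zero, matrixRep_one_matrix]

lemma pauliAct_sixteen (g : C2) : pauliAct g 16 = 16 := by
  apply pauliAct_eq
  change matrixRep g (signedPauli (0 + 16)) = signedPauli (0 + 16)
  rw [signedPauli_add_sixteen, signedPauli_zero, map_neg, matrixRep_one_matrix]

lemma mul_comm_signedPauli_of_fixed (A : cliffordUnitaries) {s : Fin 32}
    (h : pauliAct (QuotientGroup.mk A) s = s) :
    A.1.1 * signedPauli s = signedPauli s * A.1.1 := by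
  have h1 := matrixRep_signedPauli (QuotientGroup.mk A) s
  rw [h, matrixRep_mk] at h1
  conv_rhs => rw [← h1]
  rw [mul_assoc, star_mul_self_val, mul_one]

/-- A Clifford element that fixes `X ⊗ 1`, `Z ⊗ 1`, `1 ⊗ X` and `1 ⊗ Z` is trivial. -/
lemma eq_one_of_fixed {g : C2} (h4 : pauliAct g 4 = 4) (h12 : pauliAct g 12 = 12)
    (h1 : pauliAct g 1 = 1) (h3 : pauliAct g 3 = 3) : g = 1 := by
  obtain ⟨A, rfl⟩ := QuotientGroup.mk_surjective g
  rw [QuotientGroup.eq_one_iff]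
  refine ⟨A.1.1 (0, 0) (0, 0), ?_⟩
  have c4 := mul_comm_signedPauli_of_fixed A h4
  have c12 := mul_comm_signedPauli_of_fixed A h12
  have c1 := mul_comm_signedPauli_of_fixed A h1
  have c3 := mul_comm_signedPauli_of_fixed A h3
  have e4 : signedPauli (4 : Fin 32) = pauliX ⊗ₖ 1 := by simp [signedPauli, pauli]
  have e12 : signedPauli (12 : Fin 32) = pauliZ ⊗ₖ 1 := by simp [signedPauli, pauli]
  have e1 : signedPauli (1 : Fin 32) = 1 ⊗ₖ pauliX := by simp [signedPauli, pauli]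
  have e3 : signedPauli (3 : Fin 32) = 1 ⊗ₖ pauliZ := by simp [signedPauli, pauli]
  rw [e4] at c4
  rw [e12] at c12
  rw [e1] at c1
  rw [e3] at c3
  generalize A.1.1 = B at *
  simp only [← Matrix.ext_iff, Prod.forall, Fin.forall_fin_two, Matrix.mul_apply,
    Fintype.sum_prod_type, Fin.sum_univ_two, Matrix.kroneckerMap_apply, pauliX,
    pauliZ] at c4 c12 c1 c3 ⊢
  -- Commuting with `Z ⊗ 1` and `1 ⊗ Z` kills the off-diagonal entries; commuting with `X ⊗ 1` and
  -- `1 ⊗ X` then makes the diagonal entries equal.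
  simp [self_eq_neg, neg_eq_self] at c12 c3
  simp [c12, c3] at c4
  simp [c12, c3] at c1
  simp [c12, c3]
  exact ⟨c1.1.2, c4.2.1, c4.2.2.trans c1.1.2⟩

/-! ## Commutation relations -/

/-- Whether the signed Pauli matrices with numbers `s` and `t` anticommute. -/
def anticommute (s t : ℕ) : Bool :=
  ((s / 4 % 4 ≠ t / 4 % 4 ∧ s / 4 % 4 ≠ 0 ∧ t / 4 % 4 ≠ 0 : Bool) ^^
    (s % 4 ≠ t % 4 ∧ s % 4 ≠ 0 ∧ t % 4 ≠ 0 : Bool))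

lemma pauli_mul_comm {a b : ℕ} (ha : a < 4) (hb : b < 4) :
    pauli a * pauli b =
      (if a ≠ b ∧ a ≠ 0 ∧ b ≠ 0 then (-1 : ℂ) else 1) • (pauli b * pauli a) := by
  interval_cases a <;> interval_cases b <;> simp [pauli, pauliX, pauliY, pauliZ]

lemma ite_xor_eq_mul (p q : Prop) [Decidable p] [Decidable q] :
    (if (decide p ^^ decide q) = true then (-1 : ℂ) else 1) =
      (if p then -1 else 1) * (if q then -1 else 1) := by
  by_cases p <;> by_cases q <;> simp [*]

/-- Each tensor factor contributes a sign -1 exactly when its two Pauli matrices are distinct and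
different from 1; the two signs multiply, hence the exclusive or. -/
lemma signedPauli_mul_comm (s t : ℕ) : signedPauli s * signedPauli t =
    (if anticommute s t then (-1 : ℂ) else 1) • (signedPauli t * signedPauli s) := by
  simp only [signedPauli, Matrix.smul_mul, Matrix.mul_smul, ← Matrix.mul_kronecker_mul, smul_smul]
  rw [pauli_mul_comm (a := s / 4 % 4) (b := t / 4 % 4) (by omega) (by omega),
    pauli_mul_comm (a := s % 4) (b := t % 4) (by omega) (by omega), Matrix.smul_kronecker,
    Matrix.kronecker_smul, smul_smul, smul_smul]
  congr 1
  rw [anticommute, ite_xor_eq_mul]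
  ring

lemma signedPauli_mul_ne_zero (s t : ℕ) : signedPauli s * signedPauli t ≠ 0 := by
  have h (r : ℕ) : signedPauli r * signedPauli r = 1 := by
    rw [signedPauli, Matrix.smul_mul, Matrix.mul_smul, smul_smul, ← Matrix.mul_kronecker_mul,
      pauli_mul_self, pauli_mul_self, Matrix.one_kronecker_one, ← pow_add, ← two_mul, pow_mul]
    simp
  intro h0
  have : signedPauli s * (signedPauli s * signedPauli t) * signedPauli t = 1 := by
    rw [← mul_assoc, h, one_mul, h]
  rw [h0] at this
  simp at this

/-- Conjugation preserves the commutation relations. -/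
lemma anticommute_pauliAct (g : C2) (s t : Fin 32) :
    anticommute (pauliAct g s) (pauliAct g t) = anticommute s t := by
  have h1 := signedPauli_mul_comm (pauliAct g s) (pauliAct g t)
  have h2 := congrArg (matrixRep g) (signedPauli_mul_comm s t)
  rw [map_smul, matrixRep_mul_matrix, matrixRep_mul_matrix, matrixRep_signedPauli,
    matrixRep_signedPauli] at h2
  have h3 := h1.symm.trans h2
  -- Both commutation signs multiply the same nonzero product, so they agree.
  have h4 := smul_left_injective ℂ (signedPauli_mul_ne_zero (pauliAct g t) (pauliAct g s)) h3
  by_contra hne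
  rcases Bool.eq_false_or_eq_true (anticommute (pauliAct g s) (pauliAct g t)) with h | h <;>
    rcases Bool.eq_false_or_eq_true (anticommute s t) with h' | h' <;>
    simp only [h, h', not_true_eq_false] at hne h4 <;> norm_num at h4

/-! ## The action of the generators -/

/-- The index map `a ↦ -a` modulo 4 exchanges `X` and `Z`; only `Y` acquires a sign. -/
lemma hadamard_conj {a : ℕ} (ha : a < 4) : hadamard * pauli a * star hadamard =
    (-1 : ℂ) ^ (if a = 2 then 1 else 0) • pauli ((4 - a) % 4) := by
  have e : hadamard * pauli a * star hadamard =
      (2⁻¹ : ℂ) • (!![1, 1; 1, -1] * pauli a * !![1, 1; 1, -1]) := by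
    rw [star_hadamard, hadamard]
    simp only [Matrix.smul_mul, Matrix.mul_smul, smul_smul, sqrt_two_inv_sq]
  rw [e]
  interval_cases a <;> ext i j <;> fin_cases i <;> fin_cases j <;>
    simp [pauli, pauliX, pauliY, pauliZ] <;> ring

lemma phaseGate_conj {a : ℕ} (ha : a < 4) : phaseGate * pauli a * star phaseGate =
    (-1 : ℂ) ^ (if a = 2 then 1 else 0) •
      pauli (if a = 1 then 2 else if a = 2 then 1 else a) := by
  interval_cases a <;> ext i j <;> fin_cases i <;> fin_cases j <;>
    simp [pauli, pauliX, pauliY, pauliZ, phaseGate, Matrix.mul_apply, Matrix.star_apply]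

/-- The number of the signed Pauli matrix `CZ (σ_a ⊗ σ_b) CZ`. -/
def czTable (a b : ℕ) : ℕ :=
  -- The only signs occur at 25 and 22: `X ⊗ Y ↦ -(Y ⊗ X)` and `Y ⊗ X ↦ -(X ⊗ Y)`. The default 0 is
  -- not reached for `a, b < 4`.
  [0, 13, 14, 3, 7, 10, 25, 4, 11, 22, 5, 8, 12, 1, 2, 15].getD (4 * a + b) 0

lemma controlledZ_conj {a b : ℕ} (ha : a < 4) (hb : b < 4) :
    controlledZ * (pauli a ⊗ₖ pauli b) * star controlledZ = signedPauli (czTable a b) := by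
  rw [star_controlledZ, controlledZ_eq]
  ext ⟨i, j⟩ ⟨k, l⟩
  rw [Matrix.mul_diagonal, Matrix.diagonal_mul]
  revert i j k l
  interval_cases a <;> interval_cases b <;>
    simp [Fin.forall_fin_two, signedPauli, czTable, pauli, pauliX, pauliY, pauliZ]

lemma pauliAct_val_eq {g : C2} {s : Fin 32} {t : ℕ}
    (h : matrixRep g (signedPauli s) = signedPauli t) (ht : t < 32) : (pauliAct g s : ℕ) = t :=
  congrArg Fin.val (pauliAct_eq (t := ⟨t, ht⟩) h)

lemma pauliAct_tensor_left {σ : Matrix (Fin 2) (Fin 2) ℂ} (hσ : σ ∈ Matrix.unitaryGroup (Fin 2) ℂ)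
    (hm : tensor σ 1 hσ one_mem_U2 ∈ cliffordUnitaries) (u f : ℕ → ℕ) (hf : ∀ a < 4, f a < 4)
    (h : ∀ a < 4, σ * pauli a * star σ = (-1 : ℂ) ^ u a • pauli (f a)) (s : Fin 32) :
    (pauliAct (QuotientGroup.mk ⟨_, hm⟩) s : ℕ) =
      16 * ((s / 16 + u (s / 4 % 4)) % 2) + 4 * f (s / 4 % 4) + s % 4 := by
  have hf' := hf (s / 4 % 4) (by omega)
  refine pauliAct_val_eq ?_ (by omega)
  rw [signedPauli_eq _ hf' (by omega), matrixRep_mk]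
  change (σ ⊗ₖ 1) * ((-1 : ℂ) ^ ((s : ℕ) / 16) • (pauli (s / 4 % 4) ⊗ₖ pauli (s % 4))) *
    star (σ ⊗ₖ (1 : Matrix (Fin 2) (Fin 2) ℂ)) = _
  rw [Matrix.star_eq_conjTranspose, Matrix.conjTranspose_kronecker, Matrix.mul_smul,
    Matrix.smul_mul, ← Matrix.mul_kronecker_mul, ← Matrix.mul_kronecker_mul,
    ← Matrix.star_eq_conjTranspose, h _ (by omega), Matrix.smul_kronecker, smul_smul, pow_add]
  simp

lemma pauliAct_tensor_right {σ : Matrix (Fin 2) (Fin 2) ℂ}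
    (hσ : σ ∈ Matrix.unitaryGroup (Fin 2) ℂ)
    (hm : tensor 1 σ one_mem_U2 hσ ∈ cliffordUnitaries) (u f : ℕ → ℕ) (hf : ∀ a < 4, f a < 4)
    (h : ∀ a < 4, σ * pauli a * star σ = (-1 : ℂ) ^ u a • pauli (f a)) (s : Fin 32) :
    (pauliAct (QuotientGroup.mk ⟨_, hm⟩) s : ℕ) =
      16 * ((s / 16 + u (s % 4)) % 2) + 4 * (s / 4 % 4) + f (s % 4) := by
  have hf' := hf (s % 4) (by omega)
  refine pauliAct_val_eq ?_ (by omega)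
  rw [signedPauli_eq _ (by omega) hf', matrixRep_mk]
  change (1 ⊗ₖ σ) * ((-1 : ℂ) ^ ((s : ℕ) / 16) • (pauli (s / 4 % 4) ⊗ₖ pauli (s % 4))) *
    star ((1 : Matrix (Fin 2) (Fin 2) ℂ) ⊗ₖ σ) = _
  rw [Matrix.star_eq_conjTranspose, Matrix.conjTranspose_kronecker, Matrix.mul_smul,
    Matrix.smul_mul, ← Matrix.mul_kronecker_mul, ← Matrix.mul_kronecker_mul,
    ← Matrix.star_eq_conjTranspose σ, h _ (by omega), Matrix.kronecker_smul, smul_smul, pow_add]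
  simp

lemma pauliAct_CZ (s : Fin 32) :
    (pauliAct CZ s : ℕ) = (czTable (s / 4 % 4) (s % 4) + 16 * (s / 16)) % 32 := by
  refine pauliAct_val_eq ?_ (by omega)
  have h := controlledZ_conj (a := s / 4 % 4) (b := s % 4) (by omega) (by omega)
  have h1 : matrixRep CZ (signedPauli s) =
      (-1 : ℂ) ^ ((s : ℕ) / 16) • signedPauli (czTable (s / 4 % 4) (s % 4)) := by
    rw [← h, signedPauli, map_smul]
    rfl
  rw [h1]
  generalize czTable (s / 4 % 4) (s % 4) = t
  rw [signedPauli, smul_smul, ← pow_add, neg_one_pow_eq_pow_mod_two]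
  conv_rhs => rw [signedPauli, neg_one_pow_eq_pow_mod_two]
  have e1 : (t + 16 * ((s : ℕ) / 16)) % 32 / 16 % 2 = ((s : ℕ) / 16 + t / 16) % 2 := by omega
  have e2 : (t + 16 * ((s : ℕ) / 16)) % 32 / 4 % 4 = t / 4 % 4 := by omega
  have e3 : (t + 16 * ((s : ℕ) / 16)) % 32 % 4 = t % 4 := by omega
  rw [e1, e2, e3]

/-- The five generators and the inverse of `P₁`. -/
def gate : Fin 6 → C2 := ![H₁, H₂, P₁, P₂, CZ, P₁⁻¹]

/-- A map from `{0, …, 31}` to itself is encoded by the number whose digits to the base `32` are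
its values. -/
def digit (c x : ℕ) : ℕ := Nat.mod (Nat.div c (Nat.pow (nat_lit 32) x)) (nat_lit 32)

/-- The actions of `gate` on the signed Pauli matrices, as digits to the base `32`. -/
def gateCode : Fin 6 → ℕ :=
  ![1082818751424600672061239579428152272347346339872,
    1345890102731524872617850785830789258134473984096,
    1459979924750030493117134243371610308990612899872,
    1435762191590306190278269542728050712114794447936,
    1442318495496961418002374008701272623755578948000,
    1459980644127535759408761141159306261812884899872]

/-- The bridge from matrices to integers: the action of any word in the gates can be computed from
these codes. -/
lemma pauliAct_gate (k : Fin 6) (s : Fin 32) :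
    (pauliAct (gate k) s : ℕ) = digit (gateCode k) s := by
  have hP₁ (s : Fin 32) : (pauliAct P₁ s : ℕ) = digit (gateCode 2) s := by
    rw [P₁, pauliAct_tensor_left _ _ _ _ (by decide) fun a ha => phaseGate_conj ha]
    revert s
    decide +kernel
  fin_cases k
  · change (pauliAct H₁ s : ℕ) = _
    rw [H₁, pauliAct_tensor_left _ _ _ _ (fun _ _ => Nat.mod_lt _ (by norm_num))
      fun a ha => hadamard_conj ha]
    revert s
    decide +kernel
  · change (pauliAct H₂ s : ℕ) = _
    rw [H₂, pauliAct_tensor_right _ _ _ _ (fun _ _ => Nat.mod_lt _ (by norm_num))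
      fun a ha => hadamard_conj ha]
    revert s
    decide +kernel
  · exact hP₁ s
  · change (pauliAct P₂ s : ℕ) = _
    rw [P₂, pauliAct_tensor_right _ _ _ _ (by decide) fun a ha => phaseGate_conj ha]
    revert s
    decide +kernel
  · change (pauliAct CZ s : ℕ) = _
    rw [pauliAct_CZ]
    revert s
    decide +kernel
  · change (pauliAct P₁⁻¹ s : ℕ) = _
    have hlt : digit (gateCode 5) s < 32 := Nat.mod_lt _ (by norm_num)
    -- The inverse gate is identified by checking that `P₁` undoes its code.
    have h : pauliAct P₁ ⟨digit (gateCode 5) s, hlt⟩ = s := by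
      ext
      rw [hP₁]
      change digit (gateCode 2) (digit (gateCode 5) s) = s
      clear hlt
      revert s
      decide +kernel
    rw [map_inv, Equiv.Perm.inv_eq_iff_eq.2 h.symm]
    rfl

/-- The product of a word in the gates. -/
def word (w : List (Fin 6)) : C2 := (w.map gate).prod

/-- The action of a word in the gates. -/
def wordAct (w : List (Fin 6)) (x : ℕ) : ℕ := w.foldr (fun k y => digit (gateCode k) y) x

lemma pauliAct_word (w : List (Fin 6)) (s : Fin 32) :
    (pauliAct (word w) s : ℕ) = wordAct w s := by
  induction w with
  | nil => simp [word, wordAct]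
  | cons k w ih =>
    have : word (k :: w) = gate k * word w := by simp [word]
    rw [this, map_mul, Equiv.Perm.mul_apply, pauliAct_gate, ih]
    rfl

/-! ## The order of the Clifford group

The four lists below hold words that move the first, second, third and fourth of the matrices
`X ⊗ 1`, `Z ⊗ 1`, `1 ⊗ X`, `1 ⊗ Z` to all possible places and fix the preceding ones, together with
the codes of their actions. -/

/-- The words for `X ⊗ 1`. -/
def transversal₁ : List (List (Fin 6) × ℕ) :=
  [([4, 1, 0, 4], 1208331555776668678051836856638087816228409615488),
    ([4, 3, 1, 0, 4], 453317525589519037209988149542177863147264092288),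
    ([1, 4, 1, 0, 4], 500324619084191473070922488882409988882590837888),
    ([], 1459980823972598128486511383358617792788444579872),
    ([1, 4], 1328227886461445907705154938525259745218687728096),
    ([3, 1, 4], 1395308527296855830201806969436248615356643489248),
    ([4], 1442318495496961418002374008701272623755578948000),
    ([2], 1459979924750030493117134243371610308990612899872),
    ([1, 4, 2], 1328227020926843306620956409494312952613781436896),
    ([4, 1, 4], 797291870781775673250773716353235496904010680800),
    ([4, 2], 1442317629962357518843960845963418698527664093600),
    ([0], 1082818751424600672061239579428152272347346339872),
    ([1, 0, 4], 962840641066237654573579609214589734496398006496),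
    ([3, 1, 0, 4], 1029921281901646278996017006418671472011345204448),
    ([0, 4], 1076931250101751866796584045683695480410280663200),
    ([4, 1, 0, 4, 2, 2], 1208332230194366214914469269327450952009604572288),
    ([1, 4, 3, 1, 0, 4], 547423792987351961160277098563799907462542223488),
    ([1, 4, 1, 0, 4, 2, 2], 500325294905553773482426063358192219235550735488),
    ([2, 2], 1459980104593720757185197450066741809551652259872),
    ([1, 4, 2, 2], 1328227167082611372852923917561319138541177993696),
    ([1, 3, 1, 4], 667322998377563640867056595339803020536209554848),
    ([4, 2, 2], 1442317777479255052759682207883922188282226653600),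
    ([0, 2], 1082818931268290936129302786123283772908385699872),
    ([1, 0, 4, 2], 962840787222005720805547117281595920423794563296),
    ([0, 4, 1, 4], 785862053549828954192252851018820614329051826400),
    ([0, 4, 2], 1076931397618649400712305407604198970164843223200),
    ([0, 2, 2], 1082819470802105938352866477215848225169618339872),
    ([1, 0, 4, 2, 2], 962841315526470487301329329836874661022191900896),
    ([0, 4, 1, 4, 2], 785862200737078300095483140363413190246823807200),
    ([0, 4, 2, 2], 1076931925923115465282302253866384843386249124000)]

/-- The words for `Z ⊗ 1`. -/
def transversal₂ : List (List (Fin 6) × ℕ) :=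
  [([2, 0, 2], 1271399607853880057448546998070713564321428899872),
    ([0, 4, 3, 1, 4, 0], 1450744114362009161550770880112766750368511231200),
    ([1, 0, 4, 1, 4, 0], 1359446170247421046034144644914189085415326320800),
    ([4, 2, 0, 4, 2], 1140275293655773405702244794162434880046285035200),
    ([], 1459980823972598128486511383358617792788444579872),
    ([1, 0, 4, 0], 1318550745612570636547151278138920240843247900896),
    ([3, 1, 0, 4, 0], 1317793914711815179043100911192376186018797262048),
    ([0, 4, 0], 1314985411935023572544827418213320152873584138400),
    ([0, 2, 0], 517077620891773048482572366999286997636756899872),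
    ([1, 0, 4, 2, 0], 410971934155536171990374124074917758624046569696),
    ([0, 4, 1, 4, 0], 1450678605902989048362247914758441759387999717600),
    ([0, 4, 2, 0], 407406599116859640304296410295820366827216804000),
    ([0, 2, 2, 0], 705657398254108481927595921207619290044708259872),
    ([1, 0, 4, 2, 2, 0], 564227364811353423552112993153332764395989686496),
    ([0, 4, 1, 4, 2, 0], 543490057114745030890671190456478412262766463200),
    ([0, 4, 2, 2, 0], 562089277465382851747093564163093247018131364000)]

/-- The words for `1 ⊗ X`. -/
def transversal₃ : List (List (Fin 6) × ℕ) :=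
  [([], 1459980823972598128486511383358617792788444579872),
    ([3], 1435762191590306190278269542728050712114794447936),
    ([1], 1345890102731524872617850785830789258134473984096),
    ([3, 3], 1436431214584292155422143628947580888911699888672),
    ([1, 3], 1346559125725510837761724872050319434931379424832),
    ([1, 3, 3], 1368012463065994120041953827853278470867173542496)]

/-- The words for `1 ⊗ Z`. -/
def transversal₄ : List (List (Fin 6) × ℕ) :=
  [([3, 1, 3], 1392900118442272023394069827900126018678026226720),
    ([], 1459980823972598128486511383358617792788444579872),
    ([1, 3, 1], 684984587739256105822772483180471211231640357920),
    ([1, 3, 3, 1], 706393323546806990426743242205436868732614461472)]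

/-- The codes in a list of words agree with the actions of the words. -/
def CodesCorrect (T : List (List (Fin 6) × ℕ)) : Prop :=
  ∀ p ∈ T, ∀ s : Fin 32, wordAct p.1 s = digit p.2 s

instance (T : List (List (Fin 6) × ℕ)) : Decidable (CodesCorrect T) := by
  unfold CodesCorrect
  infer_instance

lemma codesCorrect₁ : CodesCorrect transversal₁ := by decide +kernel
lemma codesCorrect₂ : CodesCorrect transversal₂ := by decide +kernel
lemma codesCorrect₃ : CodesCorrect transversal₃ := by decide +kernel
lemma codesCorrect₄ : CodesCorrect transversal₄ := by decide +kernel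

/-- Every signed Pauli matrix with the commutation relations of `b` is the image of `b` under an
element of the list `T` that fixes the matrices in the list `F`. -/
def Covers (T : List (List (Fin 6) × ℕ)) (b : Fin 32) (F : List (Fin 32)) : Prop :=
  ∀ t : Fin 32, t ≠ 0 → t ≠ 16 → (∀ f ∈ F, anticommute t f = anticommute b f) →
    ∃ p ∈ T, digit p.2 b = t ∧ ∀ f ∈ F, digit p.2 f = f

instance (T : List (List (Fin 6) × ℕ)) (b : Fin 32) (F : List (Fin 32)) :
    Decidable (Covers T b F) := by
  unfold Covers
  infer_instance

/-- One step down the stabilizer chain. As `g` fixes `F` and preserves commutation relations, it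
sends `b` to a place covered by `T`; dividing by the corresponding word leaves an element that fixes
`b` as well. -/
lemma Covers.exists_mul {T : List (List (Fin 6) × ℕ)} {b : Fin 32} {F : List (Fin 32)}
    (h : Covers T b F) (hT : CodesCorrect T) (hb0 : b ≠ 0) (hb16 : b ≠ 16) {g : C2}
    (hg : ∀ f ∈ F, pauliAct g f = f) :
    ∃ i : Fin T.length, ∃ k : C2, g = word T[i].1 * k ∧ ∀ f ∈ b :: F, pauliAct k f = f := by
  have h0 : pauliAct g b ≠ 0 := fun e =>
    hb0 ((pauliAct g).injective (e.trans (pauliAct_zero g).symm))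
  have h16 : pauliAct g b ≠ 16 := fun e =>
    hb16 ((pauliAct g).injective (e.trans (pauliAct_sixteen g).symm))
  obtain ⟨p, hp, hpb, hpF⟩ := h (pauliAct g b) h0 h16 fun f hf => by
    conv_lhs => rw [← hg f hf]
    rw [anticommute_pauliAct]
  obtain ⟨i, hi, rfl⟩ := List.mem_iff_getElem.1 hp
  have key (f t : Fin 32) (hf : digit T[i].2 f = t) : pauliAct (word T[i].1) f = t := by
    ext
    rw [pauliAct_word, hT _ hp, hf]
  refine ⟨⟨i, hi⟩, (word T[i].1)⁻¹ * g, by simp, fun f hf => ?_⟩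
  rw [map_mul, map_inv, Equiv.Perm.mul_apply, Equiv.Perm.inv_eq_iff_eq]
  rcases List.mem_cons.1 hf with rfl | hf
  · exact (key _ _ hpb).symm
  · rw [hg f hf]
    exact (key _ _ (hpF f hf)).symm

/-- The indices of the elements of the Clifford group. -/
abbrev Index : Type := Fin transversal₁.length × Fin transversal₂.length ×
  Fin transversal₃.length × Fin transversal₄.length

/-- The element of the Clifford group with a given index. -/
def element (i : Index) : C2 :=
  word transversal₁[i.1].1 * (word transversal₂[i.2.1].1 *
    (word transversal₃[i.2.2.1].1 * word transversal₄[i.2.2.2].1))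

lemma element_surjective : Function.Surjective element := by
  intro g
  -- The base points 4, 12, 1, 3 are `X ⊗ 1`, `Z ⊗ 1`, `1 ⊗ X`, `1 ⊗ Z`. The admissible images
  -- number 30 (all but `±1`), 16 (anticommuting with `X ⊗ 1`), 6 (`±1 ⊗ σ` with `σ ≠ 1`) and 4 (`±1
  -- ⊗ Y`, `±1 ⊗ Z`).
  have c₁ : Covers transversal₁ 4 [] := by decide +kernel
  have c₂ : Covers transversal₂ 12 [4] := by decide +kernel
  have c₃ : Covers transversal₃ 1 [12, 4] := by decide +kernel
  have c₄ : Covers transversal₄ 3 [1, 12, 4] := by decide +kernel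
  obtain ⟨i₁, k₁, rfl, h₁⟩ := c₁.exists_mul codesCorrect₁ (by decide) (by decide) (g := g) (by simp)
  obtain ⟨i₂, k₂, rfl, h₂⟩ := c₂.exists_mul codesCorrect₂ (by decide) (by decide) h₁
  obtain ⟨i₃, k₃, rfl, h₃⟩ := c₃.exists_mul codesCorrect₃ (by decide) (by decide) h₂
  obtain ⟨i₄, k₄, rfl, h₄⟩ := c₄.exists_mul codesCorrect₄ (by decide) (by decide) h₃
  have : k₄ = 1 := eq_one_of_fixed (h₄ 4 (by simp)) (h₄ 12 (by simp)) (h₄ 1 (by simp))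
    (h₄ 3 (by simp))
  exact ⟨(i₁, i₂, i₃, i₄), by rw [this, mul_one]; rfl⟩

lemma pauliAct_word_val {T : List (List (Fin 6) × ℕ)} (hT : CodesCorrect T) (i : Fin T.length)
    (s : Fin 32) : (pauliAct (word T[i].1) s : ℕ) = digit T[i].2 s := by
  rw [pauliAct_word]
  exact hT _ (List.getElem_mem _) s

lemma pauliAct_element_val (i : Index) (s : Fin 32) : (pauliAct (element i) s : ℕ) =
    digit transversal₁[i.1].2 (digit transversal₂[i.2.1].2
      (digit transversal₃[i.2.2.1].2 (digit transversal₄[i.2.2.2].2 s))) := by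
  simp only [element, map_mul, Equiv.Perm.mul_apply, pauliAct_word_val codesCorrect₁,
    pauliAct_word_val codesCorrect₂, pauliAct_word_val codesCorrect₃,
    pauliAct_word_val codesCorrect₄]

/-- Later factors fix the earlier base points, so the image of each base point determines the index
of its factor; that factor is then cancelled. -/
lemma element_injective : Function.Injective element := by
  have d₁ : ∀ i j : Fin transversal₁.length,
      digit transversal₁[i].2 4 = digit transversal₁[j].2 4 → i = j := by decide +kernel
  have d₂ : ∀ i j : Fin transversal₂.length,
      digit transversal₂[i].2 12 = digit transversal₂[j].2 12 → i = j := by decide +kernel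
  have d₃ : ∀ i j : Fin transversal₃.length,
      digit transversal₃[i].2 1 = digit transversal₃[j].2 1 → i = j := by decide +kernel
  have d₄ : ∀ i j : Fin transversal₄.length,
      digit transversal₄[i].2 3 = digit transversal₄[j].2 3 → i = j := by decide +kernel
  have f₂ : ∀ i : Fin transversal₂.length, digit transversal₂[i].2 4 = 4 := by decide +kernel
  have f₃ : ∀ i : Fin transversal₃.length, digit transversal₃[i].2 4 = 4 ∧
      digit transversal₃[i].2 12 = 12 := by decide +kernel
  have f₄ : ∀ i : Fin transversal₄.length, digit transversal₄[i].2 4 = 4 ∧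
      digit transversal₄[i].2 12 = 12 ∧ digit transversal₄[i].2 1 = 1 := by decide +kernel
  rintro ⟨i₁, i₂, i₃, i₄⟩ ⟨j₁, j₂, j₃, j₄⟩ h
  have e₁ : i₁ = j₁ := by
    have := congrArg (fun g => (pauliAct g 4 : ℕ)) h
    simp only [pauliAct_element_val] at this
    rw [show ((4 : Fin 32) : ℕ) = 4 from rfl, (f₄ _).1, (f₃ _).1, f₂, (f₄ _).1, (f₃ _).1, f₂] at this
    exact d₁ _ _ this
  subst e₁
  have h' := mul_left_cancel h
  have e₂ : i₂ = j₂ := by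
    have := congrArg (fun g => (pauliAct g 12 : ℕ)) h'
    simp only [map_mul, Equiv.Perm.mul_apply, pauliAct_word_val codesCorrect₂,
      pauliAct_word_val codesCorrect₃, pauliAct_word_val codesCorrect₄] at this
    rw [show ((12 : Fin 32) : ℕ) = 12 from rfl, (f₄ _).2.1, (f₃ _).2, (f₄ _).2.1, (f₃ _).2] at this
    exact d₂ _ _ this
  subst e₂
  have h'' := mul_left_cancel h'
  have e₃ : i₃ = j₃ := by
    have := congrArg (fun g => (pauliAct g 1 : ℕ)) h''
    simp only [map_mul, Equiv.Perm.mul_apply, pauliAct_word_val codesCorrect₃,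
      pauliAct_word_val codesCorrect₄] at this
    rw [show ((1 : Fin 32) : ℕ) = 1 from rfl, (f₄ _).2.2, (f₄ _).2.2] at this
    exact d₃ _ _ this
  subst e₃
  have h₄ := mul_left_cancel h''
  have e₄ : i₄ = j₄ := by
    have := congrArg (fun g => (pauliAct g 3 : ℕ)) h₄
    simp only [pauliAct_word_val codesCorrect₄] at this
    exact d₄ _ _ this
  rw [e₄]

lemma element_bijective : Function.Bijective element := ⟨element_injective, element_surjective⟩

instance : Finite C2 := Finite.of_surjective _ element_surjective

lemma card_C2 : Nat.card C2 = 11520 := by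
  rw [← Nat.card_congr (Equiv.ofBijective _ element_bijective)]
  simp [Index, transversal₁, transversal₂, transversal₃, transversal₄]

/-! ## The sizes of the centralizers -/

/-- The representatives of the conjugacy classes as words in the gates. -/
def repWord : Fin 21 → List (Fin 6) :=
  ![[], [3, 2, 1, 0], [4], [4, 1, 0], [2, 2], [3, 2], [4, 0], [2], [3, 0], [1, 3, 3, 1, 4],
    [3, 2, 2], [0], [2, 0], [3, 3, 2, 0], [3, 2, 0], [4, 2, 1, 0], [1, 0],
    [0, 1, 3, 5, 4, 0, 1, 4], [2, 1, 0], [0, 4, 1, 3, 4], [4, 3, 0]]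

lemma classRep_eq_word (j : Fin 21) : classRep j = word (repWord j) := by
  fin_cases j <;> simp [classRep, word, repWord, gate, pow_two, mul_assoc]

/-- The codes of the actions of the representatives of the conjugacy classes. -/
def repCode : Fin 21 → ℕ :=
  ![1459980823972598128486511383358617792788444579872,
    1224389951832571592322984922646719740270809777248,
    1442318495496961418002374008701272623755578948000,
    1224076346952649719051191556049880218126621538400,
    1459980104593720757185197450066741809551652259872,
    1435761335923881520789015726052956950786274870336,
    927475804844215306270794640576851507068266461600,
    1459979924750030493117134243371610308990612899872,
    1058600162598451699733121062109498914143008310336,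
    688731714407511016739768651896797911674464631200,
    1435761515767613323231947211369116695283588252736,
    1082818751424600672061239579428152272347346339872,
    1271399967543318743099203964716056500814362019872,
    1247850358155012770034836210305019596937617328672,
    1247181335161026804890962124085489420140711887936,
    282277031110068095779976347887278432754074056800,
    968728073739670382072702305212237460162687846496,
    718699254638892860822042054092236379201966143744,
    1157309246302245487230543367188227966160391424096,
    781000465362702216540888513093825599927608335936,
    928144827838178636223964472097149740203745867200]

lemma pauliAct_classRep (j : Fin 21) (s : Fin 32) :
    (pauliAct (classRep j) s : ℕ) = digit (repCode j) s := by
  rw [classRep_eq_word, pauliAct_word]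
  revert j s
  decide +kernel

/-- The sum of the values of a function on a list. -/
def sumOver {α : Type} (l : List α) (f : α → ℕ) : ℕ := l.foldr (fun a n => Nat.add (f a) n) 0

lemma sumOver_eq {α : Type} (l : List α) (f : α → ℕ) : sumOver l f = ∑ i : Fin l.length, f l[i] := by
  refine Eq.trans ?_ (Fin.sum_univ_fun_getElem l f).symm
  induction l with
  | nil => rfl
  | cons a l ih =>
    rw [List.map_cons, List.sum_cons, ← ih]
    rfl

/-- Whether the composition of the actions with codes `a`, `b`, `c`, `d` commutes with the action
with code `r` at the place `x`. -/
def commutesAt (r a b c d x : ℕ) : Bool :=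
  Nat.beq (digit a (digit b (digit c (digit d (digit r x)))))
    (digit r (digit a (digit b (digit c (digit d x)))))

/-- The number of elements that commute with the element with code `r`. -/
def commutingCount (r : ℕ) : ℕ :=
  sumOver transversal₁ fun a => sumOver transversal₂ fun b =>
    sumOver transversal₃ fun c => sumOver transversal₄ fun d =>
      cond (commutesAt r a.2 b.2 c.2 d.2 4 && (commutesAt r a.2 b.2 c.2 d.2 12 &&
        (commutesAt r a.2 b.2 c.2 d.2 1 && commutesAt r a.2 b.2 c.2 d.2 3))) 1 0

lemma commutesAt_of_commute {r : C2} {n : ℕ} (hr : ∀ s, (pauliAct r s : ℕ) = digit n s) (i : Index)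
    (h : element i * r = r * element i) (s : Fin 32) :
    commutesAt n transversal₁[i.1].2 transversal₂[i.2.1].2 transversal₃[i.2.2.1].2
      transversal₄[i.2.2.2].2 s = true := by
  rw [commutesAt, ← hr, ← pauliAct_element_val, ← pauliAct_element_val, ← hr, Nat.beq_eq]
  have := congrArg (fun g => (pauliAct g s : ℕ)) h
  simpa using this

/-- Commuting elements pass the test at the four base points. Only this direction is needed, since
the upper bounds turn out to be sharp once the class sizes are added up. -/
lemma card_commuting_le {r : C2} {n : ℕ} (hr : ∀ s, (pauliAct r s : ℕ) = digit n s) :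
    Nat.card {g : C2 // g * r = r * g} ≤ commutingCount n := by
  classical
  have e : {i : Index // element i * r = r * element i} ≃ {g : C2 // g * r = r * g} :=
    (Equiv.ofBijective _ element_bijective).subtypeEquiv fun i => Iff.rfl
  rw [← Nat.card_congr e, Nat.card_eq_fintype_card, Fintype.card_subtype, Finset.card_filter,
    commutingCount]
  simp only [Fintype.sum_prod_type, sumOver_eq]
  refine Finset.sum_le_sum fun a _ => Finset.sum_le_sum fun b _ => Finset.sum_le_sum fun c _ =>
    Finset.sum_le_sum fun d _ => ?_
  split_ifs with h
  · have h' := commutesAt_of_commute hr (a, b, c, d) h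
    have h4 := h' 4
    have h12 := h' 12
    have h1 := h' 1
    have h3 := h' 3
    simp only [Fin.isValue, Fin.coe_ofNat_eq_mod, Nat.reduceMod] at h4 h12 h1 h3
    refine le_of_eq ?_
    rw [h4, h12, h1, h3]
    rfl
  · exact Nat.zero_le _

/-- The centralizer of the representative `j` is not larger than the class sizes predict. -/
def CentralizerBound (j : Fin 21) : Prop := commutingCount (repCode j) * classSize j ≤ 11520

instance (j : Fin 21) : Decidable (CentralizerBound j) := Nat.decLe _ _

lemma centralizerBound_1 : CentralizerBound 1 := by decide +kernel
lemma centralizerBound_2 : CentralizerBound 2 := by decide +kernel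
lemma centralizerBound_3 : CentralizerBound 3 := by decide +kernel
lemma centralizerBound_4 : CentralizerBound 4 := by decide +kernel
lemma centralizerBound_5 : CentralizerBound 5 := by decide +kernel
lemma centralizerBound_6 : CentralizerBound 6 := by decide +kernel
lemma centralizerBound_7 : CentralizerBound 7 := by decide +kernel
lemma centralizerBound_8 : CentralizerBound 8 := by decide +kernel
lemma centralizerBound_9 : CentralizerBound 9 := by decide +kernel
lemma centralizerBound_10 : CentralizerBound 10 := by decide +kernel
lemma centralizerBound_11 : CentralizerBound 11 := by decide +kernel
lemma centralizerBound_12 : CentralizerBound 12 := by decide +kernel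
lemma centralizerBound_13 : CentralizerBound 13 := by decide +kernel
lemma centralizerBound_14 : CentralizerBound 14 := by decide +kernel
lemma centralizerBound_15 : CentralizerBound 15 := by decide +kernel
lemma centralizerBound_16 : CentralizerBound 16 := by decide +kernel
lemma centralizerBound_17 : CentralizerBound 17 := by decide +kernel
lemma centralizerBound_18 : CentralizerBound 18 := by decide +kernel
lemma centralizerBound_19 : CentralizerBound 19 := by decide +kernel
lemma centralizerBound_20 : CentralizerBound 20 := by decide +kernel

lemma centralizerBound {j : Fin 21} (hj : j ≠ 0) : CentralizerBound j := by
  fin_cases j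
  exacts [absurd rfl hj, centralizerBound_1, centralizerBound_2, centralizerBound_3, centralizerBound_4, centralizerBound_5, centralizerBound_6, centralizerBound_7, centralizerBound_8, centralizerBound_9, centralizerBound_10, centralizerBound_11, centralizerBound_12, centralizerBound_13, centralizerBound_14, centralizerBound_15, centralizerBound_16, centralizerBound_17, centralizerBound_18, centralizerBound_19, centralizerBound_20]

lemma card_commuting_classRep_le (j : Fin 21) :
    Nat.card {g : C2 // g * classRep j = classRep j * g} * classSize j ≤ 11520 := by
  rcases eq_or_ne j 0 with rfl | hj
  -- For the identity the order of the whole group already serves as the bound.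
  · calc Nat.card {g : C2 // g * classRep 0 = classRep 0 * g} * classSize 0 ≤ Nat.card C2 * 1 :=
          Nat.mul_le_mul (Finite.card_subtype_le _) le_rfl
      _ = 11520 := by rw [card_C2]
  · exact (Nat.mul_le_mul_right _ (card_commuting_le (pauliAct_classRep j))).trans
      (centralizerBound hj)

lemma card_isConj_mul_card_commuting {G : Type*} [Group G] [Finite G] (r : G) :
    Nat.card {g : G // IsConj r g} * Nat.card {g : G // g * r = r * g} = Nat.card G := by
  classical
  have := Fintype.ofFinite G
  have := Fintype.ofFinite (MulAction.orbit (ConjAct G) r)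
  have := Fintype.ofFinite (MulAction.stabilizer (ConjAct G) r)
  have h := MulAction.card_orbit_mul_card_stabilizer_eq_card_group (ConjAct G) r
  rw [← Nat.card_eq_fintype_card, ← Nat.card_eq_fintype_card, ← Nat.card_eq_fintype_card] at h
  have e₁ : {g : G // IsConj r g} ≃ MulAction.orbit (ConjAct G) r :=
    Equiv.subtypeEquivRight fun g => by rw [ConjAct.mem_orbit_conjAct, isConj_comm]
  have e₂ : {g : G // g * r = r * g} ≃ MulAction.stabilizer (ConjAct G) r :=
    ConjAct.toConjAct.toEquiv.subtypeEquiv fun g => by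
      simp [MulAction.mem_stabilizer_iff, ConjAct.smul_def, mul_inv_eq_iff_eq_mul]
  rw [Nat.card_congr e₁, Nat.card_congr e₂, h]
  exact Nat.card_congr ConjAct.ofConjAct.toEquiv

/-- By orbit-stabilizer, an upper bound for the centralizer is a lower bound for the class. -/
lemma classSize_le (j : Fin 21) : classSize j ≤ Nat.card {g : C2 // IsConj (classRep j) g} := by
  have h₁ := card_commuting_classRep_le j
  have h₂ := card_isConj_mul_card_commuting (classRep j)
  rw [card_C2] at h₂
  rw [← h₂, mul_comm] at h₁
  have : Nonempty {g : C2 // g * classRep j = classRep j * g} := ⟨1, by simp⟩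
  exact Nat.le_of_mul_le_mul_right h₁ Nat.card_pos

/-! ## The action on the six sets of five anticommuting Pauli matrices -/

/-- The six maximal sets of pairwise anticommuting Pauli matrices. -/
def starTable : Fin 6 → List ℕ :=
  -- Each of the fifteen Pauli matrices other than 1 lies in exactly two of the sets, and each pair
  -- of sets meets in exactly one of them.
  ![[1, 2, 7, 11, 15], [1, 3, 6, 10, 14], [2, 3, 5, 9, 13], [4, 8, 13, 14, 15], [4, 9, 10, 11, 12],
    [5, 6, 7, 8, 12]]

/-- Whether the signed Pauli matrix with number `s` belongs to the set `i` up to sign. -/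
def incident (s : ℕ) (i : Fin 6) : Bool := (starTable i).contains (s % 16)

/-- The action of `gate` on the six sets. -/
def gateStar : Fin 6 → Fin 6 → Fin 6 :=
  ![![0, 1, 2, 5, 4, 3], ![2, 1, 0, 3, 4, 5], ![0, 1, 2, 3, 5, 4], ![0, 2, 1, 3, 4, 5],
    ![3, 2, 1, 0, 5, 4], ![0, 1, 2, 3, 5, 4]]

lemma gateStar_involutive : ∀ k, Function.Involutive (gateStar k) := by
  unfold Function.Involutive
  decide

/-- The action of `gate` on the six sets, as a permutation. -/
def gateStarPerm (k : Fin 6) : Equiv.Perm (Fin 6) := (gateStar_involutive k).toPerm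

/-- The permutation of the six sets that is induced by a word. -/
def wordStar (w : List (Fin 6)) : Equiv.Perm (Fin 6) := (w.map gateStarPerm).prod

lemma incident_gate (k : Fin 6) (s : Fin 32) (i : Fin 6) :
    incident (pauliAct (gate k) s) (gateStarPerm k i) = incident s i := by
  rw [pauliAct_gate]
  revert k s i
  decide +kernel

lemma incident_word (w : List (Fin 6)) (s : Fin 32) (i : Fin 6) :
    incident (pauliAct (word w) s) (wordStar w i) = incident s i := by
  induction w with
  | nil => simp [word, wordStar]
  | cons k w ih =>
    rw [← ih]
    simp only [word, wordStar, List.map_cons, List.prod_cons, map_mul, Equiv.Perm.mul_apply]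
    rw [incident_gate]

lemma word_append (w w' : List (Fin 6)) : word (w ++ w') = word w * word w' := by simp [word]

lemma word_surjective : Function.Surjective word := by
  intro g
  obtain ⟨i, rfl⟩ := element_surjective g
  refine ⟨transversal₁[i.1].1 ++ (transversal₂[i.2.1].1 ++
    (transversal₃[i.2.2.1].1 ++ transversal₄[i.2.2.2].1)), ?_⟩
  simp only [word_append]
  rfl

lemma incident_injective : ∀ i j : Fin 6, (∀ s : Fin 32, incident s i = incident s j) → i = j := by
  decide +kernel

/-- A set is determined by its members, so at most one permutation of the six sets is compatible
with a given action; this makes `starAct` a homomorphism. -/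
lemma star_eq_of_incident (σ : Equiv.Perm (Fin 32)) {i j k : Fin 6}
    (hj : ∀ s, incident (σ s) j = incident s i) (hk : ∀ s, incident (σ s) k = incident s i) :
    j = k := by
  refine incident_injective j k fun s => ?_
  obtain ⟨s, rfl⟩ := σ.surjective s
  rw [hj, hk]

lemma exists_starPerm (g : C2) : ∃ π : Equiv.Perm (Fin 6),
    ∀ (s : Fin 32) (i : Fin 6), incident (pauliAct g s) (π i) = incident s i := by
  obtain ⟨w, rfl⟩ := word_surjective g
  exact ⟨wordStar w, incident_word w⟩

/-- The action of the Clifford group on the six sets of anticommuting Pauli matrices. -/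
def starAct : C2 →* Equiv.Perm (Fin 6) where
  toFun g := (exists_starPerm g).choose
  map_one' := by
    ext1 i
    refine star_eq_of_incident (pauliAct 1) (i := i)
      (fun s => (exists_starPerm 1).choose_spec s i) fun s => ?_
    rw [map_one]
    rfl
  map_mul' g h := by
    ext1 i
    refine star_eq_of_incident (pauliAct (g * h)) (i := i)
      (fun s => (exists_starPerm (g * h)).choose_spec s i) fun s => ?_
    rw [map_mul, Equiv.Perm.mul_apply, Equiv.Perm.mul_apply, (exists_starPerm g).choose_spec,
      (exists_starPerm h).choose_spec]

lemma incident_starAct (g : C2) (s : Fin 32) (i : Fin 6) :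
    incident (pauliAct g s) (starAct g i) = incident s i :=
  (exists_starPerm g).choose_spec s i

lemma starAct_word (w : List (Fin 6)) : starAct (word w) = wordStar w := by
  ext1 i
  exact star_eq_of_incident (pauliAct (word w)) (fun s => incident_starAct (word w) s i)
    fun s => incident_word w s i

lemma starAct_classRep (j : Fin 21) : starAct (classRep j) = wordStar (repWord j) := by
  rw [classRep_eq_word, starAct_word]

/-- The pairs of a signed Pauli matrix and a set that contains it. -/
abbrev Flag : Type := {p : Fin 32 × Fin 6 // incident p.1 p.2 = true}

/-- The action of the Clifford group on the flags. -/
def flagAct : C2 →* Equiv.Perm Flag where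
  toFun g := Equiv.Perm.subtypePerm ((pauliAct g).prodCongr (starAct g)) fun p => by
    change incident (pauliAct g p.1) (starAct g p.2) = true ↔ _
    rw [incident_starAct]
  map_one' := by
    ext1 p
    apply Subtype.ext
    simp
  map_mul' g h := by
    ext1 p
    apply Subtype.ext
    change (pauliAct (g * h) p.1.1, starAct (g * h) p.1.2) =
      (pauliAct g (pauliAct h p.1.1), starAct g (starAct h p.1.2))
    rw [map_mul, map_mul]
    rfl

lemma flagAct_eq_self_iff (g : C2) (p : Flag) :
    flagAct g p = p ↔ pauliAct g p.1.1 = p.1.1 ∧ starAct g p.1.2 = p.1.2 := by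
  rw [Subtype.ext_iff, Prod.ext_iff]
  rfl

/-! ## Four characters of the Clifford group -/

/-- The number of fixed points on the six sets. -/
def starChar (g : C2) : ℂ := ((Finset.univ.filter fun i => starAct g i = i).card : ℂ)

/-- The sign of the permutation of the six sets. -/
def signChar (g : C2) : ℂ := ((Equiv.Perm.sign (starAct g) : ℤ) : ℂ)

/-- The number of fixed flags. -/
def flagChar (g : C2) : ℂ := ((Finset.univ.filter fun p => flagAct g p = p).card : ℂ)

lemma signedPauli_add_sixteen_mod (s : Fin 32) :
    signedPauli (s + 16 : Fin 32) = -signedPauli s := by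
  rw [← signedPauli_add_sixteen, Fin.val_add]
  change signedPauli (((s : ℕ) + 16) % 32) = _
  rcases Nat.lt_or_ge s 16 with h | h
  · rw [Nat.mod_eq_of_lt (by omega)]
  · have e1 : ((s : ℕ) + 16) % 32 = s - 16 := by omega
    obtain ⟨t, ht⟩ := Nat.exists_eq_add_of_le' h
    rw [e1, ht, Nat.add_sub_cancel, signedPauli_add_sixteen, signedPauli_add_sixteen, neg_neg]

lemma pauliAct_add_sixteen (g : C2) (s : Fin 32) : pauliAct g (s + 16) = pauliAct g s + 16 := by
  apply pauliAct_eq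
  rw [signedPauli_add_sixteen_mod, signedPauli_add_sixteen_mod, map_neg, matrixRep_signedPauli]

/-- Multiplying a relation by the `i`-th Pauli matrix and taking the trace leaves four times the
`i`-th coefficient. -/
lemma linearIndependent_signedPauli :
    LinearIndependent ℂ fun i : Fin 16 => signedPauli i := by
  rw [Fintype.linearIndependent_iff]
  intro c hc i
  have h := congrArg (fun M => (M * signedPauli i).trace) hc
  simp only [Finset.sum_mul, Matrix.trace_sum, Matrix.smul_mul, Matrix.trace_smul, zero_mul,
    Matrix.trace_zero, trace_signedPauli_mul] at h
  rw [Finset.sum_eq_single i] at h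
  · have h3 : (-1 : ℂ) ^ ((i : ℕ) / 16 + i / 16) = 1 := Even.neg_one_pow ⟨_, rfl⟩
    simpa [h3] using h
  · intro j _ hj
    rw [if_neg, smul_zero]
    intro h'
    exact hj (Fin.ext (by omega))
  · simp

/-- The sixteen Pauli matrices as a basis of the matrices. -/
def pauliBasis : Module.Basis (Fin 16) ℂ (Matrix (Fin 2 × Fin 2) (Fin 2 × Fin 2) ℂ) :=
  basisOfLinearIndependentOfCardEqFinrank linearIndependent_signedPauli
    (by simp [Module.finrank_matrix])

lemma pauliBasis_apply (i : Fin 16) : pauliBasis i = signedPauli i := by simp [pauliBasis]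

/-- The contribution of the Pauli matrix with number `s` to the trace of a signed permutation, if
its image has number `t`. -/
def signedFixed (s t : Fin 32) : ℤ := if t = s then 1 else if t = s + 16 then -1 else 0

lemma character_matrixRep (g : C2) : matrixRep.character g =
    ((∑ i : Fin 16, signedFixed (i.castLE (by norm_num)) (pauliAct g (i.castLE (by norm_num))) : ℤ) :
      ℂ) := by
  rw [Representation.character, trace_eq_sum_of_monomial pauliBasis _
    (fun i => ⟨pauliAct g (i.castLE (by norm_num)) % 16, Nat.mod_lt _ (by norm_num)⟩)
    (fun i => (-1) ^ ((pauliAct g (i.castLE (by norm_num)) : ℕ) / 16)), Int.cast_sum]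
  · refine Finset.sum_congr rfl fun i _ => ?_
    generalize pauliAct g (i.castLE (by norm_num)) = t
    have h : ∀ (i : Fin 16) (t : Fin 32), signedFixed (i.castLE (by norm_num)) t =
        if (⟨t % 16, Nat.mod_lt _ (by norm_num)⟩ : Fin 16) = i then (-1) ^ ((t : ℕ) / 16)
          else 0 := by
      decide +kernel
    rw [h]
    push_cast
    rfl
  · intro i
    rw [pauliBasis_apply, pauliBasis_apply]
    have h := matrixRep_signedPauli g (i.castLE (by norm_num))
    rw [Fin.val_castLE] at h
    rw [h]
    generalize pauliAct g (i.castLE (by norm_num)) = t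
    simp only [signedPauli, smul_smul, ← pow_add]
    have e1 : (t : ℕ) / 16 + t % 16 / 16 = t / 16 := by omega
    have e2 : (t : ℕ) % 16 / 4 % 4 = t / 4 % 4 := by omega
    have e3 : (t : ℕ) % 16 % 4 = t % 4 := by omega
    rw [e1, e2, e3]

lemma two_mul_sum_signedFixed (g : C2) :
    2 * ∑ i : Fin 16, signedFixed (i.castLE (by norm_num)) (pauliAct g (i.castLE (by norm_num))) =
      ∑ s : Fin 32, signedFixed s (pauliAct g s) := by
  have h16 (s t : Fin 32) : signedFixed (s + 16) (t + 16) = signedFixed s t := by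
    simp [signedFixed]
  rw [two_mul]
  refine Eq.trans ?_ (Fin.sum_univ_add (a := 16) (b := 16) _).symm
  congr 1
  refine Finset.sum_congr rfl fun i _ => ?_
  have : Fin.natAdd 16 i = (i.castLE (by norm_num) : Fin 32) + 16 := by
    revert i
    decide
  rw [this, pauliAct_add_sixteen, h16]

/-- An element fixes or negates a Pauli matrix exactly when its inverse does. Together with the
analogous facts for the other characters this gives `irrChar_inv`, which removes the inverse from
`charInner`. -/
lemma signedFixed_pauliAct_inv (g : C2) (s : Fin 32) :
    signedFixed s (pauliAct g⁻¹ s) = signedFixed s (pauliAct g s) := by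
  have h1 : pauliAct g⁻¹ s = s ↔ pauliAct g s = s := by
    rw [map_inv, Equiv.Perm.inv_eq_iff_eq, eq_comm]
  have h2 : pauliAct g⁻¹ s = s + 16 ↔ pauliAct g s = s + 16 := by
    rw [map_inv, Equiv.Perm.inv_eq_iff_eq, pauliAct_add_sixteen]
    have h16 : ∀ s : Fin 32, s + 16 + 16 = s := by decide
    constructor <;> intro h
    · nth_rw 2 [h]
      rw [h16]
    · nth_rw 1 [h]
      rw [h16]
  simp only [signedFixed, h1, h2]

lemma character_matrixRep_inv (g : C2) :
    matrixRep.character g⁻¹ = matrixRep.character g := by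
  have h : ∀ k : C2, 2 * matrixRep.character k =
      ((∑ s : Fin 32, signedFixed s (pauliAct k s) : ℤ) : ℂ) := fun k => by
    rw [← two_mul_sum_signedFixed, character_matrixRep]
    push_cast
    rfl
  have := h g⁻¹
  simp only [signedFixed_pauliAct_inv] at this
  rw [← h] at this
  exact mul_left_cancel₀ two_ne_zero this

lemma starChar_inv (g : C2) : starChar g⁻¹ = starChar g := by
  have h (i : Fin 6) : starAct g⁻¹ i = i ↔ starAct g i = i := by
    rw [map_inv, Equiv.Perm.inv_eq_iff_eq, eq_comm]
  simp only [starChar, h]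

lemma signChar_inv (g : C2) : signChar g⁻¹ = signChar g := by
  simp [signChar, Equiv.Perm.sign_inv]

lemma flagChar_inv (g : C2) : flagChar g⁻¹ = flagChar g := by
  have h (p : Flag) : flagAct g⁻¹ p = p ↔ flagAct g p = p := by
    rw [map_inv, Equiv.Perm.inv_eq_iff_eq, eq_comm]
  simp only [flagChar, h]

/-! ## The irreducible characters -/

/-- The irreducible characters as polynomials in `s = χ₂`, `v = χ₃`, `a = χ₁₄` and `g = χ₁₃`. -/
def charPolynomial {R : Type*} [CommRing R] (s v a g : R) : Fin 21 → R :=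
  -- Each difference removes the known constituents from a product of characters: `χ₃χ₁₄ = χ₁₃ + χ₁₄
  -- + χ₁₈`, with degrees 75 = 15 + 15 + 45, and so on. Multiplication by `s` is the twist by the
  -- sign.
  let c18 := v * a - g - a
  let c19 := s * c18
  let c21 := v * g - g - a
  let c20 := s * c21
  let c17 := v * c18 - a - 2 * c18 - c20 - c21
  let c9 := g * a - v - g - a - 2 * c18 - c20 - c21
  let c10 := s * c9
  let c8 := v * v - 1 - v - c9
  let c15 := v * c9 - v - c8 - c9 - c10
  let c5 := v * c8 - v - c8 - c9 - c15
  ![1, s, v, s * v, c5, s * c5, s * c8, c8, c9, c10, s * g, s * a, g, a, c15, s * c17, c17, c18,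
    c19, c20, c21]

/-- Applied to three homomorphisms: the inclusion of the ring of virtual characters, evaluation at a
group element, and the cast from `ℤ` to `ℂ`. -/
lemma map_charPolynomial {R R' : Type*} [CommRing R] [CommRing R'] (φ : R →+* R') (s v a g : R)
    (i : Fin 21) :
    φ (charPolynomial s v a g i) = charPolynomial (φ s) (φ v) (φ a) (φ g) i := by
  fin_cases i <;> simp [charPolynomial, map_ofNat]

lemma charPolynomial_mem {R : Type*} [CommRing R] (A : Subring R) {s v a g : R} (hs : s ∈ A)
    (hv : v ∈ A) (ha : a ∈ A) (hg : g ∈ A) (i : Fin 21) : charPolynomial s v a g i ∈ A := by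
  have h := map_charPolynomial A.subtype ⟨s, hs⟩ ⟨v, hv⟩ ⟨a, ha⟩ ⟨g, hg⟩ i
  exact h ▸ (charPolynomial (⟨s, hs⟩ : A) ⟨v, hv⟩ ⟨a, ha⟩ ⟨g, hg⟩ i).2

/-- The irreducible characters of the two-qubit Clifford group. -/
def irrChar : Fin 21 → C2 → ℂ :=
  charPolynomial signChar (starChar - 1) (matrixRep.character - 1)
    -- A flag without its sign is an ordered pair of distinct sets, so functions on flags that
    -- ignore the sign have character `starChar² - starChar`. The odd functions have dimension 30;
    -- those that do not depend on the chosen set give `χ₁₄`, and `χ₁₃` is the rest.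
    (flagChar - (matrixRep.character - 1) - starChar * starChar + starChar)

lemma irrChar_apply (i : Fin 21) (g : C2) : irrChar i g =
    charPolynomial (signChar g) (starChar g - 1) (matrixRep.character g - 1)
      (flagChar g - (matrixRep.character g - 1) - starChar g * starChar g + starChar g) i :=
  map_charPolynomial (Pi.evalRingHom (fun _ : C2 => ℂ) g) _ _ _ _ i

lemma irrChar_mem (i : Fin 21) : irrChar i ∈ virtualCharacters C2 := by
  have hU : starChar ∈ virtualCharacterRing C2 := fixedPoints_mem_virtualCharacters starAct
  have hS : signChar ∈ virtualCharacterRing C2 :=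
    sign_mem_virtualCharacters (Equiv.Perm.sign.comp starAct)
  have hF : flagChar ∈ virtualCharacterRing C2 := fixedPoints_mem_virtualCharacters flagAct
  have hM : matrixRep.character ∈ virtualCharacterRing C2 := character_mem_virtualCharacters _
  have hM1 := sub_mem hM (one_mem _)
  exact charPolynomial_mem (virtualCharacterRing C2) hS (sub_mem hU (one_mem _)) hM1
    (add_mem (sub_mem (sub_mem hF hM1) (mul_mem hU hU)) hU) i

lemma irrChar_inv (i : Fin 21) (g : C2) : irrChar i g⁻¹ = irrChar i g := by
  rw [irrChar_apply, irrChar_apply, starChar_inv, signChar_inv, flagChar_inv,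
    character_matrixRep_inv]

lemma matrixRep_character_eq : matrixRep.character = irrChar 0 + irrChar 13 := by
  change matrixRep.character = 1 + (matrixRep.character - 1)
  ring

/-! ## The character values -/

/-- The values of `starChar` on the conjugacy classes. -/
def starValue : Fin 21 → ℤ := ![6, 0, 0, 0, 6, 2, 0, 4, 2, 0, 4, 4, 3, 3, 1, 1, 2, 0, 1, 2, 2]

/-- The values of the character of `matrixRep` on the conjugacy classes. -/
def matrixValue : Fin 21 → ℤ :=
  ![16, 1, 4, 1, 0, 4, 2, 8, 0, 0, 0, 0, 4, 0, 2, 1, 0, 0, 0, 0, 2]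

/-- The values of `flagChar` on the conjugacy classes. -/
def flagValue : Fin 21 → ℤ := ![60, 0, 0, 0, 28, 4, 0, 24, 0, 0, 8, 12, 12, 4, 0, 0, 4, 0, 0, 0, 4]

lemma starChar_classRep (j : Fin 21) : starChar (classRep j) = starValue j := by
  rw [starChar, starAct_classRep]
  have h : ∀ j : Fin 21, ((Finset.univ.filter fun i => wordStar (repWord j) i = i).card : ℤ) =
      starValue j := by
    decide +kernel
  exact_mod_cast congrArg (Int.cast : ℤ → ℂ) (h j)

/-- Every gate permutes the six sets oddly: the controlled-`Z` gate by three disjoint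
transpositions, the others by one. -/
lemma signChar_classRep (j : Fin 21) : signChar (classRep j) = ((-1) ^ (repWord j).length : ℤ) := by
  rw [signChar, starAct_classRep]
  congr 1
  have h : ∀ k, Equiv.Perm.sign (gateStarPerm k) = -1 := by decide +kernel
  generalize repWord j = w
  induction w with
  | nil => simp [wordStar]
  | cons k w ih =>
    rw [wordStar, List.map_cons, List.prod_cons, Equiv.Perm.sign_mul, h, List.length_cons, pow_succ,
      ← ih, wordStar]
    simp

lemma matrixRep_character_classRep (j : Fin 21) :
    matrixRep.character (classRep j) = matrixValue j := by
  rw [character_matrixRep]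
  congr 1
  have e (s : Fin 32) : pauliAct (classRep j) s =
      ⟨digit (repCode j) s, Nat.mod_lt _ (by norm_num)⟩ := Fin.ext (pauliAct_classRep j s)
  simp only [e]
  clear e
  revert j
  decide +kernel

lemma flagChar_classRep (j : Fin 21) : flagChar (classRep j) = flagValue j := by
  have e (p : Flag) : flagAct (classRep j) p = p ↔
      digit (repCode j) p.1.1 = p.1.1 ∧ wordStar (repWord j) p.1.2 = p.1.2 := by
    rw [flagAct_eq_self_iff, Fin.ext_iff, pauliAct_classRep, starAct_classRep]
  simp only [flagChar, e]
  have h : ∀ j : Fin 21, ((Finset.univ.filter fun p : Flag =>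
      digit (repCode j) p.1.1 = p.1.1 ∧ wordStar (repWord j) p.1.2 = p.1.2).card : ℤ) =
      flagValue j := by
    decide +kernel
  exact_mod_cast congrArg (Int.cast : ℤ → ℂ) (h j)

lemma irrChar_classRep (i j : Fin 21) : irrChar i (classRep j) = charTable i j := by
  rw [irrChar_apply, signChar_classRep, starChar_classRep, matrixRep_character_classRep,
    flagChar_classRep]
  have h : ∀ i j : Fin 21, charPolynomial ((-1 : ℤ) ^ (repWord j).length) (starValue j - 1)
      (matrixValue j - 1) (flagValue j - (matrixValue j - 1) - starValue j * starValue j +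
        starValue j) i = charTable i j := by
    decide +kernel
  rw [← h i j]
  exact_mod_cast (map_charPolynomial (Int.castRingHom ℂ) _ _ _ _ i).symm

/-! ## The conjugacy classes -/

lemma irrChar_eq_of_isConj (i : Fin 21) {g h : C2} (hgh : IsConj g h) :
    irrChar i g = irrChar i h :=
  apply_conj_of_mem_virtualCharacters (irrChar_mem i) hgh

/-- Virtual characters are class functions, and the columns of the table are distinct. -/
lemma classRep_injective {j k : Fin 21} (h : IsConj (classRep j) (classRep k)) : j = k := by
  have hcol : ∀ j k : Fin 21, (∀ i, charTable i j = charTable i k) → j = k := by decide +kernel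
  refine hcol j k fun i => ?_
  have := irrChar_eq_of_isConj i h
  rw [irrChar_classRep, irrChar_classRep] at this
  exact_mod_cast this

/-- The elements of the conjugacy classes of the representatives. -/
abbrev ClassElement : Type := Σ j : Fin 21, {g : C2 // IsConj (classRep j) g}

lemma classElement_injective : Function.Injective fun x : ClassElement => x.2.1 := by
  rintro ⟨j, g, hg⟩ ⟨k, g', hg'⟩ (rfl : g = g')
  obtain rfl := classRep_injective (hg.trans hg'.symm)
  rfl

lemma card_classElement :
    Nat.card ClassElement = ∑ j, Nat.card {g : C2 // IsConj (classRep j) g} := Nat.card_sigma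

lemma sum_classSize : ∑ j, classSize j = 11520 := by decide +kernel

lemma le_card_classElement : Nat.card C2 ≤ Nat.card ClassElement := by
  rw [card_C2, card_classElement, ← sum_classSize]
  exact Finset.sum_le_sum fun j _ => classSize_le j

lemma classElement_bijective : Function.Bijective fun x : ClassElement => x.2.1 :=
  classElement_injective.bijective_of_nat_card_le le_card_classElement

/-- The lower bounds and the true sizes have the same sum 11520, so they agree term by term. -/
lemma card_class (j : Fin 21) : Nat.card {g : C2 // IsConj (classRep j) g} = classSize j := by
  have h : ∑ j, classSize j = ∑ j, Nat.card {g : C2 // IsConj (classRep j) g} := by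
    rw [← card_classElement, Nat.card_congr (Equiv.ofBijective _ classElement_bijective), card_C2,
      sum_classSize]
  exact ((Finset.sum_eq_sum_iff_of_le fun j _ => classSize_le j).1 h j (Finset.mem_univ j)).symm

lemma existsUnique_class (g : C2) : ∃! j : Fin 21, IsConj (classRep j) g := by
  obtain ⟨⟨j, g, hg⟩, rfl⟩ := classElement_bijective.surjective g
  exact ⟨j, hg, fun k hk => classRep_injective (hk.trans hg.symm)⟩

instance : Fintype C2 := Fintype.ofFinite C2

/-- The sum of a class function over the group. -/
lemma sum_eq_sum_classSize {F : C2 → ℂ} (hF : ∀ g h, IsConj g h → F g = F h) :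
    ∑ g, F g = ∑ j, (classSize j : ℂ) * F (classRep j) := by
  classical
  have (j : Fin 21) : Fintype {g : C2 // IsConj (classRep j) g} := Fintype.ofFinite _
  rw [← (Equiv.ofBijective _ classElement_bijective).sum_comp, Fintype.sum_sigma]
  refine Finset.sum_congr rfl fun j _ => ?_
  rw [Finset.sum_congr rfl fun g _ => (hF _ _ g.2).symm, Finset.sum_const, Finset.card_univ,
    ← Nat.card_eq_fintype_card, card_class, nsmul_eq_mul]

lemma charInner_irrChar_right {f : C2 → ℂ} (hf : f ∈ virtualCharacters C2) (i : Fin 21) :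
    charInner f (irrChar i) =
      (11520 : ℂ)⁻¹ * ∑ j, (classSize j : ℂ) * (f (classRep j) * charTable i j) := by
  rw [charInner, card_C2]
  simp only [irrChar_inv]
  rw [sum_eq_sum_classSize]
  · simp only [irrChar_classRep]
    norm_num
  · intro g h hgh
    rw [apply_conj_of_mem_virtualCharacters hf hgh, irrChar_eq_of_isConj i hgh]

lemma isIrreducibleCharacter_irrChar (i : Fin 21) : IsIrreducibleCharacter (irrChar i) := by
  have hnorm : ∀ i, ∑ j, (classSize j : ℤ) * (charTable i j * charTable i j) = 11520 := by
    decide +kernel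
  have hpos : ∀ i, charTable i 0 = ((charTable i 0).toNat : ℤ) := by decide +kernel
  refine isIrreducibleCharacter_of_norm_one (irrChar_mem i) ?_ (d := (charTable i 0).toNat) ?_
  · rw [charInner_irrChar_right (irrChar_mem i)]
    simp only [irrChar_classRep]
    have := congrArg (Int.cast : ℤ → ℂ) (hnorm i)
    push_cast at this
    rw [this]
    norm_num
  · have h := irrChar_classRep i 0
    rw [hpos i] at h
    exact_mod_cast h

lemma irrChar_injective : Function.Injective irrChar := by
  have hrow : ∀ i k : Fin 21, (∀ j, charTable i j = charTable k j) → i = k := by decide +kernel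
  intro i k h
  refine hrow i k fun j => ?_
  have := congrFun h (classRep j)
  rw [irrChar_classRep, irrChar_classRep] at this
  exact_mod_cast this

/-- The characters `irrChar i` are all the irreducible characters. -/
lemma exists_irrChar_eq {ψ : C2 → ℂ} (hψ : IsIrreducibleCharacter ψ) : ∃ i, irrChar i = ψ := by
  classical
  by_contra! hne
  have hψ' : ψ ∈ virtualCharacters C2 := Submodule.subset_span hψ
  -- A further irreducible character would be orthogonal to every row.
  have horth (i : Fin 21) : ∑ j, (classSize j : ℂ) * (ψ (classRep j) * charTable i j) = 0 := by
    have h := charInner_irreducible hψ (isIrreducibleCharacter_irrChar i)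
    rw [if_neg (hne i).symm, charInner_irrChar_right hψ'] at h
    simpa using h
  -- Weighting the rows by their degrees gives the regular character, supported at the identity;
  -- pairing it with `ψ` gives `11520 * ψ 1 = 0`.
  have hcol : ∀ j, ∑ i, charTable i j * charTable i 0 = if j = 0 then 11520 else 0 := by
    decide +kernel
  have hzero : ∑ j, (classSize j : ℂ) * ψ (classRep j) *
      ((∑ i, charTable i j * charTable i 0 : ℤ) : ℂ) = 0 := by
    calc ∑ j, (classSize j : ℂ) * ψ (classRep j) * ((∑ i, charTable i j * charTable i 0 : ℤ) : ℂ)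
        = ∑ i, (∑ j, (classSize j : ℂ) * (ψ (classRep j) * charTable i j)) * charTable i 0 := by
          push_cast
          simp only [Finset.mul_sum, Finset.sum_mul]
          rw [Finset.sum_comm]
          exact Finset.sum_congr rfl fun i _ => Finset.sum_congr rfl fun j _ => by ring
      _ = 0 := by simp only [horth, zero_mul, Finset.sum_const_zero]
  simp only [hcol] at hzero
  rw [Finset.sum_eq_single 0 (by intro j _ hj; simp [hj]) (by simp)] at hzero
  obtain ⟨n, hn, h1⟩ := hψ.apply_one_pos
  have hψ1 : ψ (classRep 0) = n := h1
  rw [hψ1] at hzero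
  have : (classSize 0 : ℂ) = 1 := by norm_num [classSize]
  rw [this] at hzero
  norm_num at hzero
  omega

end Clifford
end

theorem mainTheorem4 :
    (∀ g : Clifford.C2, ∃! j : Fin 21, IsConj (Clifford.classRep j) g) ∧
    (∀ j : Fin 21,
      Nat.card {g : Clifford.C2 // IsConj (Clifford.classRep j) g} = Clifford.classSize j) ∧
    ∃ χ : Fin 21 → Clifford.C2 → ℂ,
      Function.Injective χ ∧
      (∀ ψ : Clifford.C2 → ℂ, Clifford.IsIrreducibleCharacter ψ ↔ ∃ i, χ i = ψ) ∧
      (∀ i j, χ i (Clifford.classRep j) = (Clifford.charTable i j : ℂ)) ∧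
      Clifford.matrixRep.character = χ 0 + χ 13 :=
  ⟨Clifford.existsUnique_class, Clifford.card_class, Clifford.irrChar, Clifford.irrChar_injective,
    fun _ => ⟨Clifford.exists_irrChar_eq, fun ⟨i, hi⟩ =>
      hi ▸ Clifford.isIrreducibleCharacter_irrChar i⟩,
    Clifford.irrChar_classRep, Clifford.matrixRep_character_eq⟩
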